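/- For each $N\in\mathbb N$ let $X_N$ be a self-adjoint $N\times N$ complex random matrix, with operator norm $\|X_N\|$ and eigenvalues $\lambda_1,\dots,\lambda_N$, defined on a probability space which may depend on $N$. For $f:\mathbb R\to\mathbb C$ put $\mathrm{Tr} f(X_N)=\sum_{k=1}^N f(\lambda_k)$. Write $\mathrm{Cov}(Y,Z)=\mathbb E(YZ)-\mathbb E(Y)\,\mathbb E(Z)$ and $\mathrm{Var}(Y)=\mathbb E|Y-\mathbb E Y|^2$, and let $k_r$ denote the classical joint cumulant of order $r$. Assume that $(X_N)_N$ has a second-order limit distribution: the variables $\mathrm{Tr}(X_N^n)$ are integrable for all $n$ and $N$; for all $m,n$ the limits $$\lim_{N\to\infty}\tfrac1N\,\mathbb E\,\mathrm{Tr}(X_N^n)\quad\text{and}\quad \alpha_{m,n}=\lim_{N\to\infty}\mathrm{Cov}\big(\mathrm{Tr}(X_N^m),\mathrm{Tr}(X_N^n)\big)$$ exist; and $\lim_{N\to\infty}k_r\big(\mathrm{Tr}(X_N^{n_1}),\dots,\mathrm{Tr}(X_N^{n_r})\big)=0$ for all $r\ge 3$ and all $n_1,\dots,n_r$. Assume moreover: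 - (A1) $M>0$ is such that $\lim_{N\to\infty}N^8\,\mathbb P(\|X_N\|>M)=0$; - (A2) $K>0$ is such that $\mathrm{Var}(\mathrm{Tr} f(X_N))\le K\|f'\|_\infty^2$ for all $f\in C^1(\mathbb R)$ (complex valued) and all $N$, where the condition is void when $f'$ is unbounded. Let $C^1([-M,M])$ be the space of restrictions to $[-M,M]$ of complex valued $C^1$ functions on $\mathbb R$, and $\|h\|_M=\sup_{|x|\le M}|h(x)|$. Then there is exactly one bilinear map $\rho:C^1([-M,M])\times C^1([-M,M])\to\mathbb C$ such that $\rho(x^m,x^n)=\alpha_{m,n}$ for all $m,n\ge 0$ and $|\rho(f,g)|\le K\|f'\|_M\|g'\|_M$ for all $f,g$. Write $\rho(f,f)$ for $\rho(f|_{[-M,M]},f|_{[-M,M]})$ when $f\in C^1(\mathbb R)$. For every real-valued $f\in C^1(\mathbb R)$ with $|f|$ bounded by a polynomial, $\mathrm{Tr} f(X_N)$ is integrable for every $N$, $\rho(f,f)$ is a nonnegative real number, and $$\mathrm{Tr} f(X_N)-\mathbb E\,\mathrm{Tr} f(X_N)\Longrightarrow \mathcal N(0,\rho(f,f))$$ in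 distribution as $N\to\infty$, where $\mathcal N(0,0)$ is the point mass at $0$. -/

import Mathlib

open MeasureTheory ProbabilityTheory Filter Topology
open scoped ENNReal NNReal

universe u

noncomputable section

namespace SecondOrder

/-- A self-adjoint random matrix ensemble: for every `N` an `N × N` random matrix that is
Hermitian; the underlying probability space may depend on `N`. -/
structure SelfAdjointEnsemble (Ω : ℕ → Type u) [∀ N, MeasurableSpace (Ω N)] where
  mat : ∀ N, Ω N → Matrix (Fin N) (Fin N) ℂ
  measurable_mat : ∀ N i j, Measurable fun ω => mat N ω i j
  isHermitian : ∀ N ω, (mat N ω).IsHermitian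

/-- The classical joint cumulant `k_r(Y_1, …, Y_r)`, by the moment-cumulant formula
`∑_π (-1)^(|π|-1) (|π|-1)! ∏_{B ∈ π} E[∏_{i ∈ B} Y_i]` over the set partitions `π` of the
index set. -/
def cumulant {α : Type*} [MeasurableSpace α] (μ : Measure α) {r : ℕ} (Y : Fin r → α → ℂ) : ℂ :=
  ∑ π : Finpartition (Finset.univ : Finset (Fin r)),
    (-1 : ℂ) ^ (π.parts.card - 1) * ((π.parts.card - 1).factorial : ℂ) *
      ∏ B ∈ π.parts, ∫ a, ∏ i ∈ B, Y i a ∂μ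

/-- `Cov(Y, Z) = E(YZ) - E(Y) E(Z)` for complex random variables (no conjugation). -/
def cov {α : Type*} [MeasurableSpace α] (μ : Measure α) (Y Z : α → ℂ) : ℂ :=
  (∫ a, Y a * Z a ∂μ) - (∫ a, Y a ∂μ) * ∫ a, Z a ∂μ

/-- The space `C¹(ℝ)` of complex valued continuously differentiable functions on `ℝ`. -/
def C1 : Submodule ℂ (ℝ → ℂ) where
  carrier := {f | ContDiff ℝ 1 f}
  add_mem' {f g} hf hg := by
    have hf' : ContDiff ℝ 1 f := hf
    have hg' : ContDiff ℝ 1 g := hg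
    exact hf'.add hg'
  zero_mem' := (contDiff_const : ContDiff ℝ 1 fun _ : ℝ => (0 : ℂ))
  smul_mem' c f hf := by
    have hf' : ContDiff ℝ 1 f := hf
    exact (contDiff_const (c := c)).mul hf'

/-- The space `C¹([-M, M])` of the restrictions to `[-M, M]` of the functions in `C¹(ℝ)`. -/
def C1On (M : ℝ) : Submodule ℂ (Set.Icc (-M) M → ℂ) :=
  C1.map (LinearMap.funLeft ℂ ℂ (Subtype.val : Set.Icc (-M) M → ℝ))

/-- The restriction of `f ∈ C¹(ℝ)` to `[-M, M]`. -/
def restrict (M : ℝ) (f : C1) : C1On M :=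
  ⟨fun x => (f : ℝ → ℂ) x, f, f.2, rfl⟩

/-- The monomial `x ↦ x ^ n` as an element of `C¹(ℝ)`. -/
def monomial (n : ℕ) : C1 :=
  ⟨fun x => (x : ℂ) ^ n,
    ((Complex.ofRealCLM.contDiff).pow n : ContDiff ℝ 1 fun x : ℝ => (x : ℂ) ^ n)⟩

/-- A real valued continuously differentiable function as an element of `C¹(ℝ)`. -/
def ofRealC1 (f : ℝ → ℝ) (hf : ContDiff ℝ 1 f) : C1 :=
  ⟨fun x => (f x : ℂ),
    ((Complex.ofRealCLM.contDiff).comp hf : ContDiff ℝ 1 fun x : ℝ => (f x : ℂ))⟩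

/-- `‖h‖_M = sup {|h x| : x ∈ [-M, M]}`; it is used for continuous `h` only. -/
def supNormOn (M : ℝ) (h : ℝ → ℂ) : ℝ := ⨆ x : Set.Icc (-M) M, ‖h x‖

/-- `|f|` is dominated by a polynomial. -/
def PolynomiallyBounded (f : ℝ → ℝ) : Prop :=
  ∃ p : Polynomial ℝ, ∀ x, |f x| ≤ p.eval x

variable {Ω : ℕ → Type u} [∀ N, MeasurableSpace (Ω N)]

/-- The linear statistic `Tr(f(X_N)) = ∑ k, f(λ_k)`, the sum over the eigenvalues of `X_N`
with multiplicity, for a real or complex valued `f`. -/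
def SelfAdjointEnsemble.linStat (X : SelfAdjointEnsemble Ω) {E : Type*} [AddCommMonoid E]
    (f : ℝ → E) (N : ℕ) (ω : Ω N) : E :=
  ∑ i, f ((X.isHermitian N ω).eigenvalues i)

/-- `Tr(X_N ^ n)`. -/
def SelfAdjointEnsemble.trPow (X : SelfAdjointEnsemble Ω) (n N : ℕ) (ω : Ω N) : ℂ :=
  (X.mat N ω ^ n).trace

/-- The ensemble has a second-order limit distribution. The expectations exist (the
first field makes every product of traces of powers integrable too), the first and second order
moments converge, and the cumulants of order at least three of traces of powers vanish in the
limit. -/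
structure HasSecondOrderLimitDistribution (X : SelfAdjointEnsemble Ω)
    (P : ∀ N, Measure (Ω N)) : Prop where
  integrable : ∀ n N, Integrable (X.trPow n N) (P N)
  moment_tendsto : ∀ n, ∃ a : ℂ,
    Tendsto (fun N : ℕ => (1 / (N : ℂ)) * ∫ ω, X.trPow n N ω ∂(P N)) atTop (𝓝 a)
  cov_tendsto : ∀ m n, ∃ a : ℂ,
    Tendsto (fun N : ℕ => cov (P N) (X.trPow m N) (X.trPow n N)) atTop (𝓝 a)
  cumulant_tendsto : ∀ r, 3 ≤ r → ∀ n : Fin r → ℕ,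
    Tendsto (fun N : ℕ => cumulant (P N) (fun i => X.trPow (n i) N)) atTop (𝓝 0)

/-- The norm tail condition with constant `M`: `N ^ 8 * ℙ(‖X_N‖ > M) → 0`, with the operator norm. -/
def NormTailBound (X : SelfAdjointEnsemble Ω) (P : ∀ N, Measure (Ω N)) (M : ℝ) : Prop :=
  Tendsto (fun N : ℕ => (N : ℝ) ^ 8 *
    (P N).real {ω | M < ‖Matrix.toEuclideanCLM (𝕜 := ℂ) (X.mat N ω)‖}) atTop (𝓝 0)

/-- The Poincaré type condition with constant `K`: `Var(Tr(f(X_N))) ≤ K ‖f'‖_∞ ^ 2` for all `f ∈ C¹(ℝ)` and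
all `N`, where `Var(Z) = E|Z - E Z|²`. Both sides take values in `[0, ∞]`, so nothing is asked
of `f` when `f'` is unbounded. -/
def VarianceBound (X : SelfAdjointEnsemble Ω) (P : ∀ N, Measure (Ω N)) (K : ℝ) : Prop :=
  ∀ f ∈ C1, ∀ N,
    ∫⁻ ω, ‖X.linStat f N ω - ∫ ω', X.linStat f N ω' ∂(P N)‖ₑ ^ 2 ∂(P N) ≤
      ENNReal.ofReal K * (⨆ x : ℝ, ‖deriv f x‖ₑ) ^ 2

/-- `ρ` is a bilinear extension to `C¹([-M, M])` of the second order moments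
`ρ(x^m, x^n) = α_{m,n} = lim_N Cov(Tr(X_N^m), Tr(X_N^n))`, and is bounded by
`|ρ(f, g)| ≤ K ‖f'‖_M ‖g'‖_M`. -/
structure IsCovarianceExtension (X : SelfAdjointEnsemble Ω) (P : ∀ N, Measure (Ω N)) (M K : ℝ)
    (ρ : C1On M →ₗ[ℂ] C1On M →ₗ[ℂ] ℂ) : Prop where
  extend : ∀ m n : ℕ, Tendsto (fun N : ℕ => cov (P N) (X.trPow m N) (X.trPow n N)) atTop
    (𝓝 (ρ (restrict M (monomial m)) (restrict M (monomial n))))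
  bound : ∀ f g : C1, ‖ρ (restrict M f) (restrict M g)‖ ≤
    K * supNormOn M (deriv (f : ℝ → ℂ)) * supNormOn M (deriv (g : ℝ → ℂ))

end SecondOrder

end

/-! Everything rests on one asymptotic estimate: for a polynomially bounded `C¹` function `f`, the
standard deviation of `Tr f(X_N)` is eventually at most `√K ‖f'‖_M + ε`
(`eventually_stdDev_linStat_le`). To see this, continue `f'` outside `[-M, M]` by its boundary
values and integrate. The resulting `g` agrees with `f` on `[-M, M]` and satisfies `‖g'‖_∞ ≤
‖f'‖_M`, so (A2) applies to it. The statistic of `f - g` vanishes unless `‖X_N‖ > M`, and (A1)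
together with the moment bounds sends its `L²` norm to zero (`tendsto_l2Norm_linStat_of_eq_zero`).

Covariances of polynomial statistics converge by assumption. By Weierstrass applied to `f'`,
polynomials are dense for the seminorm `‖f'‖_M`, so by Cauchy-Schwarz covariances converge for all
polynomially bounded `C¹` functions, and the limit form obeys the bound with constant `K`
(`exists_limitForm`). A form with this bound does not see functions vanishing on `[-M, M]`, so it
descends to `C¹([-M, M])` (`exists_descent`). The same density gives uniqueness
(`eq_zero_of_monomial_eq_zero`).

For a real polynomial, the cumulants of order at least three of the centered statistic vanish in the
limit by multilinearity. Cumulants determine moments recursively, so all moments converge to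
Gaussian ones, and so do the characteristic functions (`tendsto_charFun_centered_polynomial`). For
general `f`, a polynomial close to `f` in the seminorm changes the characteristic functions and the
limit variance only slightly (`tendsto_charFun_centered`). Lévy's continuity theorem concludes. -/

/-! ### Ordered partitions as an indexing of set partitions -/

namespace OrderedFinpartition

variable {n : ℕ}

/-- The parts of an ordered finpartition as finsets. -/
def partFinset (c : OrderedFinpartition n) (m : Fin c.length) : Finset (Fin n) :=
  Finset.univ.image (c.emb m)

lemma mem_partFinset {c : OrderedFinpartition n} {m : Fin c.length} {x : Fin n} :
    x ∈ c.partFinset m ↔ ∃ r, c.emb m r = x := by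
  simp [partFinset]

lemma card_partFinset (c : OrderedFinpartition n) (m : Fin c.length) :
    (c.partFinset m).card = c.partSize m := by
  rw [partFinset, Finset.card_image_of_injective _ (c.emb_strictMono m).injective]
  simp

lemma partFinset_nonempty (c : OrderedFinpartition n) (m : Fin c.length) :
    (c.partFinset m).Nonempty :=
  Finset.card_pos.1 (by rw [card_partFinset]; exact c.partSize_pos m)

lemma disjoint_partFinset (c : OrderedFinpartition n) {i j : Fin c.length} (h : i ≠ j) :
    Disjoint (c.partFinset i) (c.partFinset j) := by
  rw [Finset.disjoint_left]
  intro x hi hj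
  obtain ⟨a, ha⟩ := mem_partFinset.1 hi
  obtain ⟨b, hb⟩ := mem_partFinset.1 hj
  exact c.emb_ne_emb_of_ne h (ha.trans hb.symm)

lemma partFinset_injective (c : OrderedFinpartition n) : Function.Injective c.partFinset := by
  intro i j h
  by_contra hne
  have := c.disjoint_partFinset hne
  rw [h, disjoint_self] at this
  exact (c.partFinset_nonempty j).ne_empty this

/-- The underlying finpartition of an ordered finpartition. -/
def toFinpartition (c : OrderedFinpartition n) : Finpartition (Finset.univ : Finset (Fin n)) where
  parts := Finset.univ.image c.partFinset
  supIndep := by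
    rw [Finset.supIndep_iff_pairwiseDisjoint]
    intro a ha b hb hab
    simp only [Finset.coe_image, Finset.coe_univ, Set.image_univ, Set.mem_range] at ha hb
    obtain ⟨i, rfl⟩ := ha
    obtain ⟨j, rfl⟩ := hb
    exact c.disjoint_partFinset fun h => hab (by rw [h])
  sup_parts := by
    ext x
    obtain ⟨m, hm⟩ := c.cover x
    simp only [Finset.mem_sup, Finset.mem_image, Finset.mem_univ, true_and, id, iff_true]
    exact ⟨_, ⟨m, rfl⟩, mem_partFinset.2 hm⟩
  bot_notMem := by
    simp only [Finset.mem_image, Finset.mem_univ, true_and, not_exists]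
    exact fun m h => (c.partFinset_nonempty m).ne_empty h

lemma max'_partFinset (c : OrderedFinpartition n) (m : Fin c.length) :
    (c.partFinset m).max' (c.partFinset_nonempty m) =
      c.emb m ⟨c.partSize m - 1, Nat.sub_one_lt_of_lt (c.partSize_pos m)⟩ := by
  refine le_antisymm (Finset.max'_le _ _ _ fun x hx => ?_)
    (Finset.le_max' _ _ (mem_partFinset.2 ⟨_, rfl⟩))
  obtain ⟨r, rfl⟩ := mem_partFinset.1 hx
  exact (c.emb_strictMono m).monotone (Fin.le_def.2 (by have := r.2; simp; omega))

lemma card_toFinpartition (c : OrderedFinpartition n) : c.toFinpartition.parts.card = c.length := by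
  rw [toFinpartition, Finset.card_image_of_injective _ c.partFinset_injective]
  simp

/-- The order carries no information: blocks are listed by increasing maximum and each block is
enumerated increasingly, so the underlying set partition forces both. -/
lemma toFinpartition_injective :
    Function.Injective (toFinpartition : OrderedFinpartition n → _) := by
  intro c d h
  have hl : c.length = d.length := by rw [← card_toFinpartition, h, card_toFinpartition]
  have hparts : Set.range c.partFinset = Set.range d.partFinset := by
    have := congrArg (fun π => (π.parts : Set (Finset (Fin n)))) h
    simpa [toFinpartition] using this
  have hmax : ∀ m : Fin c.length,
      (c.partFinset m).max' (c.partFinset_nonempty m) =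
        (d.partFinset (m.cast hl)).max' (d.partFinset_nonempty (m.cast hl)) := by
    have h1 : StrictMono fun m => (c.partFinset m).max' (c.partFinset_nonempty m) := by
      simp_rw [max'_partFinset]; exact c.parts_strictMono
    have h2 : StrictMono fun m : Fin c.length =>
        (d.partFinset (m.cast hl)).max' (d.partFinset_nonempty (m.cast hl)) := by
      simp_rw [max'_partFinset]
      exact d.parts_strictMono.comp (Fin.cast_strictMono hl)
    -- Two strictly increasing functions on `Fin` with the same range coincide.
    refine fun m => congrFun ((h1.range_inj h2).1 ?_) m
    ext x
    constructor
    · rintro ⟨m, rfl⟩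
      obtain ⟨k, hk⟩ : c.partFinset m ∈ Set.range d.partFinset := hparts ▸ ⟨m, rfl⟩
      exact ⟨k.cast hl.symm, by simp [hk]⟩
    · rintro ⟨m, rfl⟩
      obtain ⟨k, hk⟩ : d.partFinset (m.cast hl) ∈ Set.range c.partFinset := hparts ▸ ⟨_, rfl⟩
      exact ⟨k, by simp [hk]⟩
  have hpart : ∀ m : Fin c.length, c.partFinset m = d.partFinset (m.cast hl) := by
    intro m
    obtain ⟨k, hk⟩ : c.partFinset m ∈ Set.range d.partFinset := hparts ▸ ⟨m, rfl⟩
    rw [← hk]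
    congr 1
    -- Otherwise two distinct blocks of `d` would contain the same maximum.
    by_contra hne
    refine Finset.disjoint_left.1 (d.disjoint_partFinset hne) ?_
      (Finset.max'_mem _ (d.partFinset_nonempty (m.cast hl)))
    rw [← hmax m, hk]
    exact Finset.max'_mem _ _
  have hemb : ∀ m, Set.range (c.emb m) = Set.range (d.emb (m.cast hl)) := by
    intro m
    have := congrArg (fun s : Finset (Fin n) => (s : Set (Fin n))) (hpart m)
    simpa [partFinset] using this
  have hsize : ∀ m, c.partSize m = d.partSize (m.cast hl) := by
    intro m
    rw [← card_partFinset, hpart, card_partFinset]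
  clear h hparts hmax hpart
  obtain ⟨l, s, hs, e, he, hp, hd, hc⟩ := c
  obtain ⟨l', s', hs', e', he', hp', hd', hc'⟩ := d
  dsimp only at hl hemb hsize
  subst hl
  obtain rfl : s = s' := funext hsize
  obtain rfl : e = e' := funext fun m => ((he m).range_inj (he' m)).1 (hemb m)
  rfl

/-- The elements that are maximal in their own block, listed increasingly, index the blocks in the
required order. -/
lemma toFinpartition_surjective :
    Function.Surjective (toFinpartition : OrderedFinpartition n → _) := by
  intro π
  classical
  set T : Finset (Fin n) := Finset.univ.filter fun x => ∀ y ∈ π.part x, y ≤ x with hT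
  let t := T.orderEmbOfFin rfl
  have htT : ∀ i, ∀ y ∈ π.part (t i), y ≤ t i := fun i => by
    have : t i ∈ T := T.orderEmbOfFin_mem rfl i
    exact (Finset.mem_filter.1 this).2
  have hself : ∀ x, x ∈ π.part x := fun x => (π.mem_part_self).2 (Finset.mem_univ x)
  have hpos : ∀ x, 0 < (π.part x).card := fun x => Finset.card_pos.2 ⟨x, hself x⟩
  have hlast : ∀ i, (π.part (t i)).orderEmbOfFin rfl
      ⟨(π.part (t i)).card - 1, Nat.sub_one_lt_of_lt (hpos _)⟩ = t i := by
    intro i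
    rw [Finset.orderEmbOfFin_last rfl (hpos _)]
    exact le_antisymm (Finset.max'_le _ _ _ (htT i)) (Finset.le_max' _ _ (hself _))
  have hex : ∀ x, ∃ i, π.part (t i) = π.part x := by
    intro x
    set z := (π.part x).max' ⟨x, hself x⟩ with hz
    have hzx : π.part z = π.part x :=
      π.part_eq_of_mem (π.part_mem.2 (Finset.mem_univ x)) (Finset.max'_mem _ _)
    have hzT : z ∈ T := by
      rw [hT, Finset.mem_filter]
      refine ⟨Finset.mem_univ _, fun y hy => ?_⟩
      rw [hzx] at hy
      exact Finset.le_max' _ _ hy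
    have : z ∈ Set.range t := by rw [Finset.range_orderEmbOfFin]; exact hzT
    obtain ⟨i, hi⟩ := this
    exact ⟨i, by rw [hi, hzx]⟩
  refine ⟨⟨T.card, fun i => (π.part (t i)).card, fun i => hpos _,
    fun i => (π.part (t i)).orderEmbOfFin rfl, fun i => OrderEmbedding.strictMono _, ?_, ?_, ?_⟩, ?_⟩
  · simp_rw [hlast]
    exact t.strictMono
  · intro i _ j _ hij
    simp only [Function.onFun, Finset.range_orderEmbOfFin, Finset.disjoint_coe]
    have hne : π.part (t i) ≠ π.part (t j) := by
      intro h
      refine hij (t.injective (le_antisymm ?_ ?_))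
      · exact htT j _ (h ▸ hself _)
      · exact htT i _ (h ▸ hself _)
    exact π.disjoint (π.part_mem.2 (Finset.mem_univ _)) (π.part_mem.2 (Finset.mem_univ _)) hne
  · intro x
    obtain ⟨i, hi⟩ := hex x
    refine ⟨i, ?_⟩
    rw [Finset.range_orderEmbOfFin, hi]
    exact hself x
  · ext B
    simp only [toFinpartition, partFinset, Finset.mem_image, Finset.mem_univ, true_and]
    simp_rw [Finset.image_orderEmbOfFin_univ]
    constructor
    · rintro ⟨i, rfl⟩
      exact π.part_mem.2 (Finset.mem_univ _)
    · intro hB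
      obtain ⟨x, hx⟩ := π.nonempty_of_mem_parts hB
      obtain ⟨i, hi⟩ := hex x
      exact ⟨i, hi.trans (π.part_eq_of_mem hB hx)⟩

/-- Turns Faà di Bruno's formula, indexed by ordered partitions, into the shape of the
moment-cumulant formula. -/
lemma sum_eq_sum_finpartition {R : Type*} [CommSemiring R] (φ m : ℕ → R) :
    ∑ c : OrderedFinpartition n, φ c.length * ∏ i, m (c.partSize i) =
      ∑ π : Finpartition (Finset.univ : Finset (Fin n)),
        φ π.parts.card * ∏ B ∈ π.parts, m B.card := by
  refine Fintype.sum_bijective _ ⟨toFinpartition_injective, toFinpartition_surjective⟩ _ _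
    fun c => ?_
  rw [card_toFinpartition, toFinpartition,
    Finset.prod_image fun i _ j _ h => c.partFinset_injective h]
  simp_rw [card_partFinset]

end OrderedFinpartition

/-! ### Gaussian cumulants -/

namespace SecondOrder

/-- The cumulant of order `r` associated to a sequence of moments. -/
noncomputable def cumulantOfMoments (m : ℕ → ℂ) (r : ℕ) : ℂ :=
  ∑ π : Finpartition (Finset.univ : Finset (Fin r)),
    (-1 : ℂ) ^ (π.parts.card - 1) * ((π.parts.card - 1).factorial : ℂ) *
      ∏ B ∈ π.parts, m B.card

/-- The moments of a centered Gaussian variable. -/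
noncomputable def gaussianMoment (v : ℝ≥0) (n : ℕ) : ℂ := ∫ x, (x : ℂ) ^ n ∂(gaussianReal 0 v)

lemma iteratedDeriv_complexMGF_gaussianReal_zero (v : ℝ≥0) (n : ℕ) :
    iteratedDeriv n (complexMGF id (gaussianReal 0 v)) 0 = gaussianMoment v n := by
  rw [iteratedDeriv_complexMGF]
  · simp [gaussianMoment]
  · simp

lemma iteratedDeriv_sq_eq_zero (a : ℂ) {r : ℕ} (hr : 3 ≤ r) :
    iteratedDeriv r (fun z : ℂ => a * z ^ 2) 0 = 0 := by
  rw [iteratedDeriv_const_mul_field, iteratedDeriv_eq_iterate, iter_deriv_pow]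
  -- The falling factorial of 2 contains the factor `2 - 2`.
  rw [Finset.prod_eq_zero (Finset.mem_range.2 (show 2 < r by omega)) (by simp)]
  simp

/-- The logarithm of the moment generating function is `v z² / 2` near 0. Its `r`-th derivative at 0
vanishes for `r ≥ 3`, and by Faà di Bruno it equals the cumulant, since the `k`-th derivative of
`log` at 1 is `(-1)^(k-1) (k-1)!`. -/
lemma cumulantOfMoments_gaussianMoment (v : ℝ≥0) {r : ℕ} (hr : 3 ≤ r) :
    cumulantOfMoments (gaussianMoment v) r = 0 := by
  have hmgf : complexMGF id (gaussianReal 0 v) = fun z => Complex.exp ((v / 2 : ℂ) * z ^ 2) := by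
    funext z
    rw [complexMGF_gaussianReal (by rw [Measure.map_id])]
    congr 1
    push_cast
    ring
  have h0 : complexMGF id (gaussianReal 0 v) 0 = 1 := by simp [hmgf]
  have hlog : (Complex.log ∘ complexMGF id (gaussianReal 0 v)) =ᶠ[𝓝 0]
      fun z => (v / 2 : ℂ) * z ^ 2 := by
    have hc : Tendsto (fun z : ℂ => ((v / 2 : ℂ) * z ^ 2).im) (𝓝 0) (𝓝 0) := by
      have : Continuous fun z : ℂ => ((v / 2 : ℂ) * z ^ 2).im := by fun_prop
      simpa using this.tendsto 0
    -- `log` inverts `exp` only where the imaginary part lies in `(-π, π]`, which holds near 0.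
    filter_upwards [hc.eventually (Ioo_mem_nhds (neg_lt_zero.2 Real.pi_pos) Real.pi_pos)]
      with z hz
    simp only [hmgf, Function.comp]
    exact Complex.log_exp hz.1 hz.2.le
  have key := iteratedDeriv_comp_eq_sum_orderedFinpartition (𝕜 := ℂ) (i := r) (n := r) (x := 0)
    (g := Complex.log) (f := complexMGF id (gaussianReal 0 v))
    (by rw [h0]; exact Complex.contDiffAt_log Complex.one_mem_slitPlane)
    (by rw [hmgf]; fun_prop) le_rfl
  rw [hlog.iteratedDeriv_eq, iteratedDeriv_sq_eq_zero _ hr, h0] at key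
  simp_rw [iteratedDeriv_complexMGF_gaussianReal_zero] at key
  rw [OrderedFinpartition.sum_eq_sum_finpartition
    (fun k => iteratedDeriv k Complex.log 1) (gaussianMoment v)] at key
  rw [cumulantOfMoments, key]
  refine Finset.sum_congr rfl fun π _ => ?_
  congr 1
  have hpos : 0 < π.parts.card := by
    rw [Finset.card_pos]
    refine π.parts_nonempty ?_
    have : NeZero r := ⟨by omega⟩
    exact Finset.univ_nonempty.ne_empty
  obtain ⟨k, hk⟩ : ∃ k, π.parts.card = k + 1 := ⟨_, (Nat.succ_pred_eq_of_pos hpos).symm⟩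
  rw [hk, iteratedDeriv_succ_log Complex.one_mem_slitPlane]
  simp

end SecondOrder

namespace SecondOrder

/-! ### The method of moments -/

section MomentMethod

lemma gaussianMoment_zero (v : ℝ≥0) : gaussianMoment v 0 = 1 := by simp [gaussianMoment]

lemma integrable_pow_gaussianReal (v : ℝ≥0) (n : ℕ) :
    Integrable (fun x : ℝ => x ^ n) (gaussianReal 0 v) := by
  have h : MemLp id (n : ℝ≥0∞) (gaussianReal 0 v) := by
    simpa using memLp_id_gaussianReal (μ := 0) (v := v) (n : ℝ≥0)
  refine (integrable_norm_iff (by fun_prop)).1 ?_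
  simpa using h.integrable_norm_pow'

lemma gaussianMoment_eq_ofReal (v : ℝ≥0) (n : ℕ) :
    gaussianMoment v n = ((∫ x, x ^ n ∂(gaussianReal 0 v) : ℝ) : ℂ) := by
  rw [gaussianMoment, ← integral_complex_ofReal]
  simp

lemma gaussianMoment_one (v : ℝ≥0) : gaussianMoment v 1 = 0 := by
  rw [gaussianMoment_eq_ofReal]
  simp

lemma gaussianMoment_two (v : ℝ≥0) : gaussianMoment v 2 = (v : ℝ) := by
  rw [gaussianMoment_eq_ofReal]
  have h := variance_fun_id_gaussianReal (μ := 0) (v := v)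
  rw [variance_eq_integral measurable_id'.aemeasurable] at h
  simp only [integral_id_gaussianReal, sub_zero] at h
  rw [h]

lemma card_lt_of_ne_indiscrete {r : ℕ} (hr : (Finset.univ : Finset (Fin r)) ≠ ⊥)
    {π : Finpartition (Finset.univ : Finset (Fin r))} (hπ : π ≠ Finpartition.indiscrete hr)
    {B : Finset (Fin r)} (hB : B ∈ π.parts) : B.card < r := by
  have hle : B.card ≤ r := by simpa using Finset.card_le_univ B
  refine lt_of_le_of_ne hle fun h => hπ ?_
  have hBu : B = Finset.univ := (Finset.card_eq_iff_eq_univ B).1 (by simpa using h)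
  subst hBu
  ext C
  simp only [Finpartition.indiscrete_parts, Finset.mem_singleton]
  constructor
  · intro hC
    by_contra hne
    have := π.disjoint hC hB hne
    obtain ⟨x, hx⟩ := π.nonempty_of_mem_parts hC
    exact Finset.disjoint_left.1 this hx (Finset.mem_univ x)
  · rintro rfl
    exact hB

/-- The one-block partition has coefficient 1, and all others have strictly smaller blocks. Hence
the `r`-th moment is the `r`-th cumulant plus a polynomial in lower moments, which drives the
induction below. -/
lemma cumulantOfMoments_eq_add {r : ℕ} (hr : (Finset.univ : Finset (Fin r)) ≠ ⊥) (m : ℕ → ℂ) :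
    cumulantOfMoments m r = m r +
      ∑ π ∈ Finset.univ.erase (Finpartition.indiscrete hr),
        (-1 : ℂ) ^ (π.parts.card - 1) * ((π.parts.card - 1).factorial : ℂ) *
          ∏ B ∈ π.parts, m B.card := by
  rw [cumulantOfMoments, ← Finset.add_sum_erase _ _ (Finset.mem_univ (Finpartition.indiscrete hr))]
  simp

/-- Convergence of the cumulants to those of a centered Gaussian variable implies convergence of
the moments. -/
lemma tendsto_gaussianMoment_of_cumulants {m : ℕ → ℕ → ℂ} {v : ℝ≥0}
    (h0 : ∀ N, m N 0 = 1) (h1 : ∀ N, m N 1 = 0)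
    (h2 : Tendsto (fun N => m N 2) atTop (𝓝 ((v : ℝ) : ℂ)))
    (hc : ∀ r, 3 ≤ r → Tendsto (fun N => cumulantOfMoments (m N) r) atTop (𝓝 0)) (k : ℕ) :
    Tendsto (fun N => m N k) atTop (𝓝 (gaussianMoment v k)) := by
  induction k using Nat.strong_induction_on with
  | _ k ih =>
    rcases lt_or_ge k 3 with hk | hk
    · interval_cases k
      · simp [h0, gaussianMoment_zero]
      · simp [h1, gaussianMoment_one]
      · simpa [gaussianMoment_two] using h2
    · have hne : (Finset.univ : Finset (Fin k)) ≠ ⊥ := by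
        have : NeZero k := ⟨by omega⟩
        exact Finset.univ_nonempty.ne_empty
      have e1 : gaussianMoment v k = 0 - ∑ π ∈ Finset.univ.erase (Finpartition.indiscrete hne),
          (-1 : ℂ) ^ (π.parts.card - 1) * ((π.parts.card - 1).factorial : ℂ) *
            ∏ B ∈ π.parts, gaussianMoment v B.card := by
        rw [eq_sub_iff_add_eq, ← cumulantOfMoments_eq_add,
          cumulantOfMoments_gaussianMoment v hk]
      have e2 : ∀ N, m N k = cumulantOfMoments (m N) k -
          ∑ π ∈ Finset.univ.erase (Finpartition.indiscrete hne),
          (-1 : ℂ) ^ (π.parts.card - 1) * ((π.parts.card - 1).factorial : ℂ) *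
            ∏ B ∈ π.parts, m N B.card := fun N => by
        rw [eq_sub_iff_add_eq, ← cumulantOfMoments_eq_add]
      simp_rw [e2]
      rw [e1]
      refine (hc k hk).sub (tendsto_finsetSum _ fun π hπ => ?_)
      refine Tendsto.const_mul _ (tendsto_finsetProd _ fun B hB => ?_)
      exact ih _ (card_lt_of_ne_indiscrete hne (Finset.ne_of_mem_erase hπ) hB)

/-- Taylor's formula on `[0, 1]` for `s ↦ exp(s i y)`, whose `k`-th derivative has norm `|y| ^ k`.
The denominator `n!` is not optimal but suffices. -/
lemma norm_cexp_I_mul_sub_sum_le (y : ℝ) (n : ℕ) :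
    ‖Complex.exp (y * Complex.I) -
      ∑ k ∈ Finset.range (n + 1), ((k.factorial : ℂ))⁻¹ * (y * Complex.I) ^ k‖ ≤
      |y| ^ (n + 1) / n.factorial := by
  set f : ℝ → ℂ := fun s => Complex.exp (s * (y * Complex.I)) with hf
  have hd : ∀ k, iteratedDeriv k f = fun s => (y * Complex.I) ^ k * f s := by
    intro k
    induction k with
    | zero => simp
    | succ k ih =>
      rw [iteratedDeriv_succ, ih]
      funext s
      have : HasDerivAt f (f s * (y * Complex.I)) s := by
        have h1 : HasDerivAt (fun s : ℝ => (s : ℂ) * (y * Complex.I)) (1 * (y * Complex.I)) s :=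
          (HasDerivAt.ofReal_comp (hasDerivAt_id s)).mul_const _
        simpa using h1.cexp
      rw [(this.const_mul _).deriv]
      ring
  have hcont : ContDiff ℝ ⊤ f := by
    exact (Complex.ofRealCLM.contDiff.mul contDiff_const).cexp
  have hw : ∀ k, ∀ s ∈ Set.Icc (0 : ℝ) 1, iteratedDerivWithin k f (Set.Icc 0 1) s =
      (y * Complex.I) ^ k * f s := fun k s hs => by
    rw [iteratedDerivWithin_eq_iteratedDeriv (uniqueDiffOn_Icc zero_lt_one)
      (hcont.of_le le_top).contDiffAt hs, hd]
  have := taylor_mean_remainder_bound (f := f) (a := 0) (b := 1) (x := 1) (C := |y| ^ (n + 1))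
    (n := n) zero_le_one ((hcont.of_le le_top).contDiffOn) (by simp) fun s hs => by
      rw [hw _ _ hs, norm_mul, norm_pow, norm_mul, Complex.norm_I, mul_one, Complex.norm_real]
      have : ‖f s‖ = 1 := by
        simp only [hf]
        rw [← mul_assoc, ← Complex.ofReal_mul, Complex.norm_exp_ofReal_mul_I]
      rw [this, mul_one, Real.norm_eq_abs]
  rw [taylor_within_apply] at this
  refine le_trans (le_of_eq ?_) (this.trans (le_of_eq (by simp)))
  congr 2
  · simp [hf]
  · refine Finset.sum_congr rfl fun k _ => ?_
    rw [hw k 0 (by simp)]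
    simp [hf]

/-- The remainder is taken of even order, so that it is bounded by a moment rather than an absolute
moment. -/
lemma norm_charFun_sub_sum_le (ν : Measure ℝ) [IsProbabilityMeasure ν]
    (hint : ∀ k : ℕ, Integrable (fun x : ℝ => x ^ k) ν) (t : ℝ) (j : ℕ) :
    ‖charFun ν t - ∑ k ∈ Finset.range (2 * j + 2),
        ((k.factorial : ℂ))⁻¹ * (t * Complex.I) ^ k * ∫ x, (x : ℂ) ^ k ∂ν‖ ≤
      |t| ^ (2 * j + 2) / (2 * j + 1).factorial * ∫ x, x ^ (2 * j + 2) ∂ν := by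
  have hintC : ∀ k : ℕ, Integrable (fun x : ℝ => (x : ℂ) ^ k) ν := fun k => by
    simpa using (hint k).ofReal (𝕜 := ℂ)
  rw [charFun_apply_real]
  have hsum : ∑ k ∈ Finset.range (2 * j + 2),
      ((k.factorial : ℂ))⁻¹ * (t * Complex.I) ^ k * ∫ x, (x : ℂ) ^ k ∂ν =
      ∫ x : ℝ, ∑ k ∈ Finset.range (2 * j + 2),
        ((k.factorial : ℂ))⁻¹ * ((t * x : ℝ) * Complex.I) ^ k ∂ν := by
    rw [integral_finsetSum]
    · refine Finset.sum_congr rfl fun k _ => ?_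
      rw [← integral_const_mul]
      congr 1
      funext x
      push_cast
      ring
    · intro k _
      refine ((hintC k).const_mul (((k.factorial : ℂ))⁻¹ * (t * Complex.I) ^ k)).congr
        (ae_of_all _ fun x => ?_)
      push_cast
      ring
  have hi1 : Integrable (fun x : ℝ => Complex.exp (t * x * Complex.I)) ν := by
    refine (integrable_const (1 : ℝ)).mono' (by fun_prop) (ae_of_all _ fun x => ?_)
    rw [← Complex.ofReal_mul, Complex.norm_exp_ofReal_mul_I]
  have hi2 : Integrable (fun x : ℝ => ∑ k ∈ Finset.range (2 * j + 2),
        ((k.factorial : ℂ))⁻¹ * ((t * x : ℝ) * Complex.I) ^ k) ν := by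
    refine integrable_finsetSum _ fun k _ => ?_
    refine ((hintC k).const_mul (((k.factorial : ℂ))⁻¹ * (t * Complex.I) ^ k)).congr
      (ae_of_all _ fun x => ?_)
    push_cast
    ring
  rw [hsum, ← integral_sub hi1 hi2, ← integral_const_mul]
  refine norm_integral_le_of_norm_le ((hint _).const_mul _) (ae_of_all _ fun x => ?_)
  have := norm_cexp_I_mul_sub_sum_le (t * x) (2 * j + 1)
  rw [Complex.ofReal_mul] at this ⊢
  refine this.trans (le_of_eq ?_)
  rw [abs_mul, mul_pow, show 2 * j + 1 + 1 = 2 * (j + 1) by ring, pow_mul |x|, sq_abs, ← pow_mul]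
  ring

lemma tendsto_gaussian_taylor_remainder (v : ℝ≥0) (t : ℝ) :
    Tendsto (fun j : ℕ => |t| ^ (2 * j + 2) / (2 * j + 1).factorial *
      ∫ x, x ^ (2 * j + 2) ∂(gaussianReal 0 v)) atTop (𝓝 0) := by
  set E := ∫ x, Real.exp (|2 * t * x|) ∂(gaussianReal 0 v) with hE
  have hiE : Integrable (fun x : ℝ => Real.exp (|2 * t * x|)) (gaussianReal 0 v) := by
    have h1 := integrable_exp_mul_gaussianReal (μ := 0) (v := v) (2 * t)
    have h2 := integrable_exp_mul_gaussianReal (μ := 0) (v := v) (-(2 * t))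
    refine (h1.add h2).mono' (by fun_prop) (ae_of_all _ fun x => ?_)
    rw [Real.norm_eq_abs, Real.abs_exp]
    simp only [Pi.add_apply]
    rcases abs_choice (2 * t * x) with h | h <;> rw [h]
    · linarith [Real.exp_pos (-(2 * t) * x)]
    · rw [← neg_mul]
      linarith [Real.exp_pos (2 * t * x)]
  have hbound : ∀ j : ℕ, |t| ^ (2 * j + 2) / (2 * j + 1).factorial *
      ∫ x, x ^ (2 * j + 2) ∂(gaussianReal 0 v) ≤
        (2 * j + 2) * (1 / 4) ^ j * E := by
    intro j
    rw [hE, ← integral_const_mul, ← integral_const_mul]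
    refine integral_mono ((integrable_pow_gaussianReal v _).const_mul _) (hiE.const_mul _)
      fun x => ?_
    have hp := Real.pow_div_factorial_le_exp (|2 * t * x|) (abs_nonneg _) (2 * j + 2)
    have hx : x ^ (2 * j + 2) = |x| ^ (2 * j + 2) := by
      rw [show 2 * j + 2 = 2 * (j + 1) by ring, pow_mul, pow_mul, sq_abs]
    have hfac : ((2 * j + 2).factorial : ℝ) = (2 * j + 2) * (2 * j + 1).factorial := by
      rw [show 2 * j + 2 = (2 * j + 1) + 1 by ring, Nat.factorial_succ]; push_cast; ring
    have hfp : (0 : ℝ) < (2 * j + 1).factorial := by positivity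
    -- Inserting `2 ^ (2j + 2)` gains the geometric factor `(1/4) ^ (j + 1)`; the rest is a term of
    -- the series of `exp |2tx|`, which is Gaussian integrable.
    have e : |t| ^ (2 * j + 2) / (2 * j + 1).factorial * x ^ (2 * j + 2) =
        (2 * j + 2) * (1 / 4) ^ (j + 1) * (|2 * t * x| ^ (2 * j + 2) / (2 * j + 2).factorial) := by
      rw [hx, hfac, abs_mul, abs_mul, mul_pow, mul_pow]
      have : (|2| : ℝ) ^ (2 * j + 2) = 4 ^ (j + 1) := by
        rw [abs_two, show 2 * j + 2 = 2 * (j + 1) by ring, pow_mul]; norm_num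
      rw [this, one_div, inv_pow]
      field_simp
    simp only
    rw [e]
    have h4 : ((1 : ℝ) / 4) ^ (j + 1) ≤ (1 / 4) ^ j :=
      pow_le_pow_of_le_one (by norm_num) (by norm_num) (Nat.le_succ j)
    gcongr
  have hlim : Tendsto (fun j : ℕ => ((2 : ℝ) * j + 2) * (1 / 4) ^ j * E) atTop (𝓝 0) := by
    have h1 := tendsto_self_mul_const_pow_of_abs_lt_one (r := (1 / 4 : ℝ))
      (by rw [abs_lt]; constructor <;> norm_num)
    have h2 := tendsto_pow_atTop_nhds_zero_of_abs_lt_one (r := (1 / 4 : ℝ))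
      (by rw [abs_lt]; constructor <;> norm_num)
    have h3 := ((h1.const_mul 2).add (h2.const_mul 2)).mul_const E
    simp only [mul_zero, add_zero, zero_mul] at h3
    refine h3.congr fun j => ?_
    ring
  refine squeeze_zero (fun j => ?_) hbound hlim
  refine mul_nonneg (by positivity) (integral_nonneg fun x => ?_)
  exact (show Even (2 * j + 2) from ⟨j + 1, by ring⟩).pow_nonneg x

/-- The **method of moments** for a centered Gaussian limit. -/
lemma tendsto_charFun_of_tendsto_moments {ν : ℕ → Measure ℝ} [∀ N, IsProbabilityMeasure (ν N)]
    {v : ℝ≥0} (hint : ∀ N (k : ℕ), Integrable (fun x : ℝ => x ^ k) (ν N))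
    (hm : ∀ k : ℕ, Tendsto (fun N => ∫ x, (x : ℂ) ^ k ∂(ν N)) atTop (𝓝 (gaussianMoment v k)))
    (t : ℝ) :
    Tendsto (fun N => charFun (ν N) t) atTop (𝓝 (charFun (gaussianReal 0 v) t)) := by
  rw [Metric.tendsto_atTop]
  intro ε hε
  -- The order `j` is fixed by the Gaussian remainder alone. The remainder of `ν N` converges to it,
  -- being a multiple of a moment, so no bound uniform in both `j` and `N` is needed.
  obtain ⟨j, hj⟩ := ((tendsto_gaussian_taylor_remainder v t).eventually
    (gt_mem_nhds (show (0 : ℝ) < ε / 4 by positivity))).exists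
  have hre : Tendsto (fun N => |t| ^ (2 * j + 2) / (2 * j + 1).factorial *
      ∫ x, x ^ (2 * j + 2) ∂(ν N)) atTop (𝓝 (|t| ^ (2 * j + 2) / (2 * j + 1).factorial *
      ∫ x, x ^ (2 * j + 2) ∂(gaussianReal 0 v))) := by
    refine Tendsto.const_mul _ ?_
    have h := (Complex.continuous_re.tendsto _).comp (hm (2 * j + 2))
    rw [gaussianMoment_eq_ofReal, Complex.ofReal_re] at h
    refine h.congr fun N => ?_
    simp only [Function.comp]
    rw [← Complex.ofReal_re (∫ x, x ^ (2 * j + 2) ∂(ν N)), ← integral_complex_ofReal]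
    simp
  have hsum : Tendsto (fun N => ∑ k ∈ Finset.range (2 * j + 2),
        ((k.factorial : ℂ))⁻¹ * (t * Complex.I) ^ k * ∫ x, (x : ℂ) ^ k ∂(ν N)) atTop
      (𝓝 (∑ k ∈ Finset.range (2 * j + 2),
        ((k.factorial : ℂ))⁻¹ * (t * Complex.I) ^ k * gaussianMoment v k)) :=
    tendsto_finsetSum _ fun k _ => (hm k).const_mul _
  obtain ⟨N₀, hN₀⟩ := eventually_atTop.1 ((hre.eventually (gt_mem_nhds hj)).and
    (Metric.tendsto_nhds.1 hsum (ε / 4) (by positivity)))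
  refine ⟨N₀, fun N hN => ?_⟩
  obtain ⟨h1, h2⟩ := hN₀ N hN
  have h3 := norm_charFun_sub_sum_le (ν N) (hint N) t j
  have h4 := norm_charFun_sub_sum_le (gaussianReal 0 v) (integrable_pow_gaussianReal v) t j
  rw [dist_eq_norm] at h2 ⊢
  simp only [gaussianMoment] at h2
  set a := charFun (ν N) t
  set b := charFun (gaussianReal 0 v) t
  set A := ∑ k ∈ Finset.range (2 * j + 2),
        ((k.factorial : ℂ))⁻¹ * (t * Complex.I) ^ k * ∫ x, (x : ℂ) ^ k ∂(ν N)
  set B := ∑ k ∈ Finset.range (2 * j + 2),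
        ((k.factorial : ℂ))⁻¹ * (t * Complex.I) ^ k * ∫ x, (x : ℂ) ^ k ∂(gaussianReal 0 v)
  calc ‖a - b‖ = ‖(a - A) + (A - B) - (b - B)‖ := by congr 1; ring
    _ ≤ ‖a - A‖ + ‖A - B‖ + ‖b - B‖ := (norm_sub_le _ _).trans (by gcongr; exact norm_add_le _ _)
    _ < ε := by linarith

end MomentMethod

end SecondOrder

namespace SecondOrder

/-! ### Measurability and growth of linear statistics -/

section LinearStatistics

variable {Ω : ℕ → Type u} [∀ N, MeasurableSpace (Ω N)] (X : SelfAdjointEnsemble Ω)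

lemma trace_pow_eq_sum_eigenvalues {n : Type*} [Fintype n] [DecidableEq n] {A : Matrix n n ℂ}
    (hA : A.IsHermitian) (k : ℕ) : (A ^ k).trace = ∑ i, (hA.eigenvalues i : ℂ) ^ k := by
  conv_lhs => rw [hA.spectral_theorem, ← map_pow, Matrix.diagonal_pow]
  rw [Unitary.conjStarAlgAut_apply, Matrix.trace_mul_comm, ← mul_assoc]
  simp [Matrix.trace]

lemma abs_eigenvalues_le_norm {n : Type*} [Fintype n] [DecidableEq n] {A : Matrix n n ℂ}
    (hA : A.IsHermitian) (i : n) :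
    |hA.eigenvalues i| ≤ ‖Matrix.toEuclideanCLM (𝕜 := ℂ) A‖ := by
  have h1 : Matrix.toEuclideanCLM (𝕜 := ℂ) A (hA.eigenvectorBasis i) =
      (hA.eigenvalues i : ℂ) • hA.eigenvectorBasis i := by
    apply (WithLp.ofLp_injective 2)
    rw [Matrix.ofLp_toEuclideanCLM, hA.mulVec_eigenvectorBasis]
    simp
  have h2 := (Matrix.toEuclideanCLM (𝕜 := ℂ) A).le_opNorm (hA.eigenvectorBasis i)
  rw [h1, norm_smul] at h2
  simpa using h2

lemma trPow_eq (n N : ℕ) : X.trPow n N = X.linStat (fun x : ℝ => (x : ℂ) ^ n) N := by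
  funext ω
  exact trace_pow_eq_sum_eigenvalues (X.isHermitian N ω) n

lemma measurable_trPow (n N : ℕ) : Measurable (X.trPow n N) := by
  have h : ∀ k i j, Measurable fun ω => (X.mat N ω ^ k) i j := by
    intro k
    induction k with
    | zero => intro i j; simp only [pow_zero]; exact measurable_const
    | succ k ih =>
      intro i j
      simp only [pow_succ, Matrix.mul_apply]
      exact Finset.measurable_fun_sum _ fun l _ => (ih i l).mul (X.measurable_mat N l j)
  have e : X.trPow n N = fun ω => ∑ i, (X.mat N ω ^ n) i i := rfl
  rw [e]
  exact Finset.measurable_fun_sum _ fun i _ => h n i i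

lemma linStat_apply {E : Type*} [AddCommMonoid E] (f : ℝ → E) (N : ℕ) (ω : Ω N) :
    X.linStat f N ω = ∑ i, f ((X.isHermitian N ω).eigenvalues i) := rfl

section algebra

variable {E : Type*} [AddCommGroup E]

lemma linStat_add (f g : ℝ → E) (N : ℕ) :
    X.linStat (f + g) N = X.linStat f N + X.linStat g N := by
  funext ω
  simp [SelfAdjointEnsemble.linStat, Finset.sum_add_distrib]

lemma linStat_sub (f g : ℝ → E) (N : ℕ) :
    X.linStat (f - g) N = X.linStat f N - X.linStat g N := by
  funext ω
  simp [SelfAdjointEnsemble.linStat, Finset.sum_sub_distrib]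

lemma linStat_smul {R : Type*} [Semiring R] [Module R E] (c : R) (f : ℝ → E) (N : ℕ) :
    X.linStat (c • f) N = c • X.linStat f N := by
  funext ω
  simp [SelfAdjointEnsemble.linStat, Finset.smul_sum]

lemma linStat_sum {ι : Type*} (s : Finset ι) (f : ι → ℝ → E) (N : ℕ) :
    X.linStat (∑ i ∈ s, f i) N = ∑ i ∈ s, X.linStat (f i) N := by
  funext ω
  simp only [SelfAdjointEnsemble.linStat, Finset.sum_apply]
  exact Finset.sum_comm

end algebra

lemma linStat_ofReal (f : ℝ → ℝ) (N : ℕ) (ω : Ω N) :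
    X.linStat (fun x : ℝ => (f x : ℂ)) N ω = ((X.linStat f N ω : ℝ) : ℂ) := by
  simp [SelfAdjointEnsemble.linStat]

lemma linStat_re (f : ℝ → ℂ) (N : ℕ) (ω : Ω N) :
    (X.linStat f N ω).re = X.linStat (fun x => (f x).re) N ω := by
  simp [SelfAdjointEnsemble.linStat]

lemma linStat_im (f : ℝ → ℂ) (N : ℕ) (ω : Ω N) :
    (X.linStat f N ω).im = X.linStat (fun x => (f x).im) N ω := by
  simp [SelfAdjointEnsemble.linStat]

lemma measurable_linStat_pow (n N : ℕ) : Measurable (X.linStat (fun x : ℝ => x ^ n) N) := by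
  have h := Complex.measurable_re.comp (measurable_trPow X n N)
  rw [trPow_eq] at h
  have e : X.linStat (fun x : ℝ => x ^ n) N =
      Complex.re ∘ X.linStat (fun x : ℝ => (x : ℂ) ^ n) N := by
    funext ω
    simp [linStat_re, ← Complex.ofReal_pow]
  rwa [e]

/-- Measurability of the individual eigenvalues is avoided: traces of powers are polynomials in the
entries, and `f` is a pointwise limit of polynomials, the `k`-th being `1/(k+1)`-close to `f` on
`[-k, k]`. -/
lemma measurable_linStat_real {f : ℝ → ℝ} (hf : Continuous f) (N : ℕ) :
    Measurable (X.linStat f N) := by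
  have hp : ∀ p : Polynomial ℝ, Measurable (X.linStat (fun x => p.eval x) N) := by
    intro p
    have : (fun x => p.eval x) = ∑ k ∈ Finset.range (p.natDegree + 1),
        p.coeff k • fun x : ℝ => x ^ k := by
      funext x
      simp [Polynomial.eval_eq_sum_range]
    rw [this, linStat_sum]
    rw [Finset.sum_fn]
    refine Finset.measurable_fun_sum _ fun k _ => ?_
    rw [linStat_smul]
    exact (measurable_linStat_pow X k N).const_smul _
  choose p hpx using fun k : ℕ => exists_polynomial_near_of_continuousOn (-(k : ℝ)) k f
    hf.continuousOn (1 / ((k : ℝ) + 1)) (by positivity)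
  refine measurable_of_tendsto_metrizable (fun k => hp (p k)) (tendsto_pi_nhds.2 fun ω => ?_)
  refine tendsto_finsetSum _ fun i _ => ?_
  rw [tendsto_iff_norm_sub_tendsto_zero]
  refine squeeze_zero' (Eventually.of_forall fun _ => norm_nonneg _) ?_
    tendsto_one_div_add_atTop_nhds_zero_nat
  obtain ⟨k₀, hk₀⟩ := exists_nat_ge |(X.isHermitian N ω).eigenvalues i|
  filter_upwards [eventually_ge_atTop k₀] with k hk
  refine (hpx k _ (abs_le.1 (hk₀.trans ?_))).le
  exact_mod_cast hk

lemma measurable_linStat {f : ℝ → ℂ} (hf : Continuous f) (N : ℕ) :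
    Measurable (X.linStat f N) := by
  have h : X.linStat f N = fun ω => ((X.linStat (fun x => (f x).re) N ω : ℝ) : ℂ) +
      (X.linStat (fun x => (f x).im) N ω : ℝ) * Complex.I := by
    funext ω
    rw [← linStat_re, ← linStat_im, Complex.re_add_im]
  rw [h]
  exact (Complex.measurable_ofReal.comp
    (measurable_linStat_real X (Complex.continuous_re.comp hf) N)).add
    ((Complex.measurable_ofReal.comp
    (measurable_linStat_real X (Complex.continuous_im.comp hf) N)).mul_const _)

/-- The linear statistic of the envelope `1 + x ^ (2 m)`. -/
noncomputable def envelope (m N : ℕ) : Ω N → ℝ := X.linStat (fun x : ℝ => 1 + x ^ (2 * m)) N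

lemma envelope_nonneg (m N : ℕ) (ω : Ω N) : 0 ≤ envelope X m N ω := by
  rw [envelope, linStat_apply]
  refine Finset.sum_nonneg fun i _ => ?_
  rw [pow_mul]
  positivity

lemma measurable_envelope (m N : ℕ) : Measurable (envelope X m N) :=
  measurable_linStat_real X (by fun_prop) N

/-- Cauchy-Schwarz over the `N` eigenvalues and `(1 + y)² ≤ 2 (1 + y²)`. Squaring is thus traded for
a doubled degree, at the cost of a factor `2N`. -/
lemma envelope_sq_le (m N : ℕ) (ω : Ω N) :
    envelope X m N ω ^ 2 ≤ 2 * N * envelope X (2 * m) N ω := by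
  have h := sq_sum_le_card_mul_sum_sq (s := Finset.univ)
    (f := fun i => 1 + (X.isHermitian N ω).eigenvalues i ^ (2 * m))
  rw [Finset.card_univ, Fintype.card_fin] at h
  refine h.trans ?_
  rw [mul_comm 2 (N : ℝ), mul_assoc, envelope]
  refine mul_le_mul_of_nonneg_left ?_ (Nat.cast_nonneg N)
  rw [linStat_apply, Finset.mul_sum]
  refine Finset.sum_le_sum fun i _ => ?_
  set y := (X.isHermitian N ω).eigenvalues i ^ (2 * m) with hy
  rw [show 2 * (2 * m) = (2 * m) * 2 by ring, pow_mul, ← hy]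
  nlinarith [sq_nonneg (1 - y)]

lemma norm_linStat_le {f : ℝ → ℂ} {C : ℝ} {m : ℕ} (h : ∀ x, ‖f x‖ ≤ C * (1 + x ^ (2 * m)))
    (N : ℕ) (ω : Ω N) : ‖X.linStat f N ω‖ ≤ C * envelope X m N ω := by
  rw [envelope, SelfAdjointEnsemble.linStat, SelfAdjointEnsemble.linStat, Finset.mul_sum]
  exact norm_sum_le_of_le _ fun i _ => h _

/-- `f` is dominated by a multiple of some `1 + x ^ (2 m)`. -/
def PolyGrowth (f : ℝ → ℂ) : Prop :=
  ∃ (C : ℝ) (m : ℕ), ∀ x, ‖f x‖ ≤ C * (1 + x ^ (2 * m))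

lemma one_add_pow_le {k m : ℕ} (h : k ≤ m) (x : ℝ) :
    1 + x ^ (2 * k) ≤ 2 * (1 + x ^ (2 * m)) := by
  rw [pow_mul, pow_mul]
  have hx := sq_nonneg x
  rcases le_total (x ^ 2) 1 with h1 | h1
  · have := pow_le_one₀ (n := k) hx h1
    have := pow_nonneg hx m
    linarith
  · have := pow_le_pow_right₀ h1 h
    have := pow_nonneg hx m
    linarith

lemma PolyGrowth.mono_exponent {f : ℝ → ℂ} {C : ℝ} {k m : ℕ}
    (h : ∀ x, ‖f x‖ ≤ C * (1 + x ^ (2 * k))) (hkm : k ≤ m) :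
    ∀ x, ‖f x‖ ≤ 2 * |C| * (1 + x ^ (2 * m)) := fun x => by
  have h0 : 0 ≤ 1 + x ^ (2 * k) := by rw [pow_mul]; positivity
  calc ‖f x‖ ≤ C * (1 + x ^ (2 * k)) := h x
    _ ≤ |C| * (2 * (1 + x ^ (2 * m))) :=
      mul_le_mul (le_abs_self C) (one_add_pow_le hkm x) h0 (abs_nonneg C)
    _ = _ := by ring

lemma PolyGrowth.add {f g : ℝ → ℂ} (hf : PolyGrowth f) (hg : PolyGrowth g) :
    PolyGrowth (f + g) := by
  obtain ⟨C, k, hC⟩ := hf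
  obtain ⟨D, l, hD⟩ := hg
  refine ⟨2 * |C| + 2 * |D|, max k l, fun x => ?_⟩
  have h1 := PolyGrowth.mono_exponent hC (le_max_left k l) x
  have h2 := PolyGrowth.mono_exponent hD (le_max_right k l) x
  rw [add_mul]
  exact (norm_add_le _ _).trans (add_le_add h1 h2)

lemma PolyGrowth.smul {f : ℝ → ℂ} (c : ℂ) (hf : PolyGrowth f) : PolyGrowth (c • f) := by
  obtain ⟨C, k, hC⟩ := hf
  refine ⟨‖c‖ * C, k, fun x => ?_⟩
  rw [Pi.smul_apply, norm_smul, mul_assoc]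
  exact mul_le_mul_of_nonneg_left (hC x) (norm_nonneg c)

lemma PolyGrowth.sub {f g : ℝ → ℂ} (hf : PolyGrowth f) (hg : PolyGrowth g) :
    PolyGrowth (f - g) := by
  have := hf.add (hg.smul (-1))
  simpa [sub_eq_add_neg] using this

lemma polyGrowth_zero : PolyGrowth 0 := ⟨0, 0, fun x => by simp⟩

lemma polyGrowth_pow (n : ℕ) : PolyGrowth fun x : ℝ => (x : ℂ) ^ n := by
  refine ⟨1, n, fun x => ?_⟩
  rw [norm_pow, Complex.norm_real, one_mul, mul_comm, pow_mul, ← sq_abs (x ^ n), Real.norm_eq_abs,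
    abs_pow]
  nlinarith [sq_nonneg (|x| ^ n - 1), sq_nonneg (|x| ^ n)]

lemma PolyGrowth.sum {ι : Type*} (s : Finset ι) {f : ι → ℝ → ℂ} (h : ∀ i ∈ s, PolyGrowth (f i)) :
    PolyGrowth (∑ i ∈ s, f i) := by
  classical
  induction s using Finset.induction_on with
  | empty => simpa using polyGrowth_zero
  | insert a s ha ih =>
    rw [Finset.sum_insert ha]
    exact (h a (Finset.mem_insert_self a s)).add
      (ih fun i hi => h i (Finset.mem_insert_of_mem hi))

lemma polynomial_eq_sum (p : Polynomial ℂ) : (fun x : ℝ => p.eval (x : ℂ)) =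
    ∑ k ∈ Finset.range (p.natDegree + 1), p.coeff k • fun x : ℝ => (x : ℂ) ^ k := by
  funext x
  simp [Polynomial.eval_eq_sum_range]

lemma polyGrowth_polynomial (p : Polynomial ℂ) : PolyGrowth fun x : ℝ => p.eval (x : ℂ) := by
  rw [polynomial_eq_sum]
  exact PolyGrowth.sum _ fun k _ => (polyGrowth_pow k).smul _

end LinearStatistics

/-! ### Moments of linear statistics -/

section Integrability

variable {Ω : ℕ → Type u} [∀ N, MeasurableSpace (Ω N)] {P : ∀ N, Measure (Ω N)}
  [∀ N, IsProbabilityMeasure (P N)] {X : SelfAdjointEnsemble Ω}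

lemma envelope_eq (m N : ℕ) (ω : Ω N) :
    envelope X m N ω = N + (X.trPow (2 * m) N ω).re := by
  rw [trPow_eq, linStat_re]
  simp [envelope, SelfAdjointEnsemble.linStat, Finset.sum_add_distrib, ← Complex.ofReal_pow]

lemma integrable_envelope (hX : HasSecondOrderLimitDistribution X P) (m N : ℕ) :
    Integrable (envelope X m N) (P N) := by
  have : envelope X m N = fun ω => (N : ℝ) + (X.trPow (2 * m) N ω).re :=
    funext fun ω => envelope_eq m N ω
  rw [this]
  exact (integrable_const _).add (hX.integrable (2 * m) N).re

/-- The normalized moments `(1/N) E Tr(X_N^(2m))` converge, hence are bounded. -/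
lemma exists_integral_envelope_le (hX : HasSecondOrderLimitDistribution X P) (m : ℕ) :
    ∃ A : ℝ, 0 ≤ A ∧ ∀ N : ℕ, ∫ ω, envelope X m N ω ∂(P N) ≤ A * N := by
  obtain ⟨a, ha⟩ := hX.moment_tendsto (2 * m)
  obtain ⟨A, hA⟩ := (Metric.isBounded_range_of_tendsto _ ha).exists_norm_le
  have hA0 : 0 ≤ A := (norm_nonneg _).trans (hA _ ⟨0, rfl⟩)
  refine ⟨1 + A, by positivity, fun N => ?_⟩
  rcases Nat.eq_zero_or_pos N with rfl | hN
  · simp [envelope, SelfAdjointEnsemble.linStat]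
  have hN' : (0 : ℝ) < N := by exact_mod_cast hN
  have h1 : ∫ ω, envelope X m N ω ∂(P N) = N + (∫ ω, X.trPow (2 * m) N ω ∂(P N)).re := by
    simp_rw [envelope_eq]
    have hre : Integrable (fun ω => (X.trPow (2 * m) N ω).re) (P N) :=
      (hX.integrable (2 * m) N).re
    have h := integral_re (hX.integrable (2 * m) N)
    simp only [RCLike.re_to_complex] at h
    rw [integral_add (integrable_const _) hre, h]
    simp
  have h2 := hA _ ⟨N, rfl⟩
  simp only [norm_mul, norm_div, norm_one, Complex.norm_natCast] at h2
  have h3 : ‖∫ ω, X.trPow (2 * m) N ω ∂(P N)‖ ≤ A * N := by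
    rw [one_div, inv_mul_le_iff₀ hN'] at h2
    linarith
  rw [h1]
  linarith [Complex.re_le_norm (∫ ω, X.trPow (2 * m) N ω ∂(P N))]

/-- Iterating `envelope_sq_le` reduces every power to the integrability of a single trace; thus
integrable traces of powers already have moments of all orders. -/
lemma integrable_envelope_pow_two_pow (hX : HasSecondOrderLimitDistribution X P) (N j : ℕ) :
    ∀ m, Integrable (fun ω => envelope X m N ω ^ (2 ^ j)) (P N) := by
  induction j with
  | zero => intro m; simpa using integrable_envelope hX m N
  | succ j ih =>
    intro m
    refine ((ih (2 * m)).const_mul ((2 * N) ^ (2 ^ j) : ℝ)).mono'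
      ((measurable_envelope X m N).pow_const _).aestronglyMeasurable (ae_of_all _ fun ω => ?_)
    rw [Real.norm_of_nonneg (pow_nonneg (envelope_nonneg X m N ω) _), pow_succ', pow_mul, ← mul_pow]
    exact pow_le_pow_left₀ (sq_nonneg _) (envelope_sq_le X m N ω) _

lemma integrable_envelope_pow (hX : HasSecondOrderLimitDistribution X P) (m N k : ℕ) :
    Integrable (fun ω => envelope X m N ω ^ k) (P N) := by
  refine ((integrable_const (1 : ℝ)).add (integrable_envelope_pow_two_pow hX N k m)).mono'
    ((measurable_envelope X m N).pow_const _).aestronglyMeasurable (ae_of_all _ fun ω => ?_)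
  have h0 := envelope_nonneg X m N ω
  rw [Real.norm_of_nonneg (pow_nonneg h0 _)]
  simp only [Pi.add_apply]
  rcases le_total (envelope X m N ω) 1 with h1 | h1
  · linarith [pow_le_one₀ (n := k) h0 h1, pow_nonneg h0 (2 ^ k)]
  · linarith [pow_le_pow_right₀ h1 (Nat.lt_two_pow_self (n := k)).le]

lemma memLp_linStat (hX : HasSecondOrderLimitDistribution X P) {f : ℝ → ℂ} (hf : Continuous f)
    (hg : PolyGrowth f) (N k : ℕ) : MemLp (X.linStat f N) k (P N) := by
  rcases Nat.eq_zero_or_pos k with rfl | hk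
  · simpa using (measurable_linStat X hf N).aestronglyMeasurable
  obtain ⟨C, m, hC⟩ := hg
  have h1 : MemLp (envelope X m N) k (P N) := by
    rw [← integrable_norm_rpow_iff (measurable_envelope X m N).aestronglyMeasurable
      (by exact_mod_cast hk.ne') (ENNReal.natCast_ne_top k)]
    refine (integrable_envelope_pow hX m N k).congr (ae_of_all _ fun ω => ?_)
    simp [abs_of_nonneg (envelope_nonneg X m N ω)]
  exact (h1.const_mul C).mono' (measurable_linStat X hf N).aestronglyMeasurable
    (ae_of_all _ fun ω => norm_linStat_le X hC N ω)

lemma memLp_two_linStat (hX : HasSecondOrderLimitDistribution X P) {f : ℝ → ℂ} (hf : Continuous f)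
    (hg : PolyGrowth f) (N : ℕ) : MemLp (X.linStat f N) 2 (P N) := by
  exact_mod_cast memLp_linStat hX hf hg N 2

lemma integrable_linStat (hX : HasSecondOrderLimitDistribution X P) {f : ℝ → ℂ} (hf : Continuous f)
    (hg : PolyGrowth f) (N : ℕ) : Integrable (X.linStat f N) (P N) :=
  (memLp_two_linStat hX hf hg N).integrable (by norm_num)

lemma integrable_prod_linStat (hX : HasSecondOrderLimitDistribution X P) {ι : Type*}
    (s : Finset ι) {f : ι → ℝ → ℂ} (hf : ∀ i ∈ s, Continuous (f i))
    (hg : ∀ i ∈ s, PolyGrowth (f i)) (N : ℕ) :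
    Integrable (fun ω => ∏ i ∈ s, X.linStat (f i) N ω) (P N) := by
  rcases s.eq_empty_or_nonempty with rfl | hs
  · simp
  -- Hölder's inequality with all exponents equal to the number of factors.
  have h := MemLp.prod' (p := fun _ => (s.card : ℝ≥0∞)) (s := s)
    fun i hi => memLp_linStat hX (hf i hi) (hg i hi) N s.card
  rw [← memLp_one_iff_integrable]
  convert h using 1
  rw [Finset.sum_const, nsmul_eq_mul, ENNReal.mul_inv_cancel]
  · simp
  · exact_mod_cast hs.card_ne_zero
  · exact ENNReal.natCast_ne_top _

end Integrability

end SecondOrder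

namespace SecondOrder

/-! ### Standard deviation and covariance -/

section StandardDeviation

variable {α : Type*} [MeasurableSpace α] {μ : Measure α} {Y Z W : α → ℂ}

/-- The `L²` seminorm of a complex random variable. -/
noncomputable def l2Norm (μ : Measure α) (Z : α → ℂ) : ℝ := (eLpNorm Z 2 μ).toReal

/-- The standard deviation of a complex random variable. -/
noncomputable def stdDev (μ : Measure α) (Z : α → ℂ) : ℝ := l2Norm μ fun ω => Z ω - ∫ ω', Z ω' ∂μ

lemma l2Norm_nonneg (Z : α → ℂ) : 0 ≤ l2Norm μ Z := ENNReal.toReal_nonneg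

lemma stdDev_nonneg (Z : α → ℂ) : 0 ≤ stdDev μ Z := ENNReal.toReal_nonneg

lemma l2Norm_add_le (hY : MemLp Y 2 μ) (hZ : MemLp Z 2 μ) :
    l2Norm μ (Y + Z) ≤ l2Norm μ Y + l2Norm μ Z := by
  rw [l2Norm, l2Norm, l2Norm, ← ENNReal.toReal_add hY.eLpNorm_ne_top hZ.eLpNorm_ne_top]
  exact ENNReal.toReal_mono (ENNReal.add_ne_top.2 ⟨hY.eLpNorm_ne_top, hZ.eLpNorm_ne_top⟩)
    (eLpNorm_add_le hY.1 hZ.1 (by norm_num))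

lemma l2Norm_sq (hZ : MemLp Z 2 μ) : l2Norm μ Z ^ 2 = ∫ ω, ‖Z ω‖ ^ 2 ∂μ := by
  have h := hZ.eLpNorm_eq_integral_rpow_norm (by norm_num) (by norm_num)
  have h0 : 0 ≤ ∫ ω, ‖Z ω‖ ^ 2 ∂μ := integral_nonneg fun _ => by positivity
  simp only [ENNReal.toReal_ofNat, Real.rpow_ofNat] at h
  rw [l2Norm, h, ENNReal.toReal_ofReal (by positivity), ← Real.rpow_natCast,
    ← Real.rpow_mul h0]
  norm_num

lemma norm_integral_mul_le (hY : MemLp Y 2 μ) (hZ : MemLp Z 2 μ) :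
    ‖∫ ω, Y ω * Z ω ∂μ‖ ≤ l2Norm μ Y * l2Norm μ Z := by
  refine (norm_integral_le_integral_norm _).trans ?_
  have h : eLpNorm (Y • Z) 1 μ ≤ eLpNorm Y 2 μ * eLpNorm Z 2 μ :=
    eLpNorm_smul_le_mul_eLpNorm hZ.1 hY.1
  have e : (fun ω => Y ω * Z ω) = Y • Z := rfl
  rw [integral_norm_eq_lintegral_enorm (f := fun ω => Y ω * Z ω) (hY.1.mul hZ.1),
    ← eLpNorm_one_eq_lintegral_enorm, l2Norm, l2Norm, ← ENNReal.toReal_mul, e]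
  exact ENNReal.toReal_mono (ENNReal.mul_ne_top hY.eLpNorm_ne_top hZ.eLpNorm_ne_top) h

lemma integrable_mul_of_memLp_two (hY : MemLp Y 2 μ) (hZ : MemLp Z 2 μ) :
    Integrable (fun ω => Y ω * Z ω) μ :=
  hY.integrable_mul hZ

lemma cov_comm (Y Z : α → ℂ) : cov μ Y Z = cov μ Z Y := by
  simp only [cov, mul_comm]

lemma cov_smul_left (c : ℂ) (Y Z : α → ℂ) : cov μ (c • Y) Z = c * cov μ Y Z := by
  simp only [cov, Pi.smul_apply, smul_eq_mul, mul_assoc]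
  rw [integral_const_mul, integral_const_mul]
  ring

lemma cov_smul_right (c : ℂ) (Y Z : α → ℂ) : cov μ Y (c • Z) = c * cov μ Y Z := by
  rw [cov_comm, cov_smul_left, cov_comm]

variable [IsProbabilityMeasure μ]

lemma integral_norm_le_l2Norm (hZ : MemLp Z 2 μ) : ∫ ω, ‖Z ω‖ ∂μ ≤ l2Norm μ Z := by
  have h := eLpNorm_le_eLpNorm_of_exponent_le (p := 1) (q := 2) (by norm_num) hZ.1
  rw [integral_norm_eq_lintegral_enorm hZ.1, ← eLpNorm_one_eq_lintegral_enorm]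
  exact ENNReal.toReal_mono hZ.eLpNorm_ne_top h

lemma memLp_sub_integral (hZ : MemLp Z 2 μ) : MemLp (fun ω => Z ω - ∫ ω', Z ω' ∂μ) 2 μ :=
  hZ.sub (memLp_const _)

lemma stdDev_add_le (hY : MemLp Y 2 μ) (hZ : MemLp Z 2 μ) :
    stdDev μ (Y + Z) ≤ stdDev μ Y + stdDev μ Z := by
  refine le_trans (le_of_eq ?_) (l2Norm_add_le (memLp_sub_integral hY) (memLp_sub_integral hZ))
  rw [stdDev]
  congr 1
  funext ω
  simp only [Pi.add_apply]
  rw [integral_add (hY.integrable (by norm_num)) (hZ.integrable (by norm_num))]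
  ring

lemma stdDev_le_two_mul_l2Norm (hZ : MemLp Z 2 μ) : stdDev μ Z ≤ 2 * l2Norm μ Z := by
  have h := l2Norm_add_le hZ (memLp_const (μ := μ) (p := 2) (-∫ ω', Z ω' ∂μ))
  have h1 : l2Norm μ (fun _ : α => -∫ ω', Z ω' ∂μ) = ‖∫ ω', Z ω' ∂μ‖ := by
    rw [l2Norm, eLpNorm_const _ (by norm_num) (IsProbabilityMeasure.ne_zero μ)]
    simp
  rw [h1] at h
  have h2 : ‖∫ ω', Z ω' ∂μ‖ ≤ l2Norm μ Z :=
    (norm_integral_le_integral_norm _).trans (integral_norm_le_l2Norm hZ)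
  have h3 : stdDev μ Z = l2Norm μ (Z + fun _ => -∫ ω', Z ω' ∂μ) := by
    rw [stdDev]
    congr 1
  linarith

lemma cov_eq_integral (hY : MemLp Y 2 μ) (hZ : MemLp Z 2 μ) :
    cov μ Y Z = ∫ ω, (Y ω - ∫ ω', Y ω' ∂μ) * (Z ω - ∫ ω', Z ω' ∂μ) ∂μ := by
  have hY1 := hY.integrable (q := 2) (by norm_num)
  have hZ1 := hZ.integrable (q := 2) (by norm_num)
  have hYZ := integrable_mul_of_memLp_two hY hZ
  have hY2 : Integrable (fun ω => Y ω * ∫ ω', Z ω' ∂μ) μ := hY1.mul_const _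
  have hZ2 : Integrable (fun ω => (∫ ω', Y ω' ∂μ) * (Z ω - ∫ ω', Z ω' ∂μ)) μ :=
    (hZ1.sub (integrable_const _)).const_mul _
  have hYZ2 : Integrable (fun ω => Y ω * Z ω - Y ω * ∫ ω', Z ω' ∂μ) μ := hYZ.sub hY2
  have e : ∀ ω, (Y ω - ∫ ω', Y ω' ∂μ) * (Z ω - ∫ ω', Z ω' ∂μ) =
      Y ω * Z ω - Y ω * ∫ ω', Z ω' ∂μ - (∫ ω', Y ω' ∂μ) * (Z ω - ∫ ω', Z ω' ∂μ) := fun ω => by ring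
  simp_rw [e]
  rw [integral_sub hYZ2 hZ2, integral_sub hYZ hY2, integral_mul_const,
    integral_const_mul, integral_sub hZ1 (integrable_const _), cov]
  simp

lemma norm_cov_le (hY : MemLp Y 2 μ) (hZ : MemLp Z 2 μ) :
    ‖cov μ Y Z‖ ≤ stdDev μ Y * stdDev μ Z := by
  rw [cov_eq_integral hY hZ]
  exact norm_integral_mul_le (memLp_sub_integral hY) (memLp_sub_integral hZ)

lemma cov_add_left (hY : MemLp Y 2 μ) (hZ : MemLp Z 2 μ) (hW : MemLp W 2 μ) :
    cov μ (Y + Z) W = cov μ Y W + cov μ Z W := by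
  simp only [cov, Pi.add_apply, add_mul]
  rw [integral_add (integrable_mul_of_memLp_two hY hW) (integrable_mul_of_memLp_two hZ hW),
    integral_add (hY.integrable (by norm_num)) (hZ.integrable (by norm_num))]
  ring

lemma cov_add_right (hY : MemLp Y 2 μ) (hZ : MemLp Z 2 μ) (hW : MemLp W 2 μ) :
    cov μ W (Y + Z) = cov μ W Y + cov μ W Z := by
  rw [cov_comm, cov_add_left hY hZ hW, cov_comm Y, cov_comm Z]

end StandardDeviation

/-! ### Extension from the interval without increasing the derivative -/

section Extension

/-- A `C¹` function on `[-M, M]` extends to `ℝ` with the same bound for the derivative. -/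
lemma exists_extension_deriv_le {f : ℝ → ℂ} (hf : ContDiff ℝ 1 f) {M : ℝ} (hM : 0 < M) {L : ℝ}
    (hL : ∀ x ∈ Set.Icc (-M) M, ‖deriv f x‖ ≤ L) :
    ∃ g : ℝ → ℂ, ContDiff ℝ 1 g ∧ (∀ x ∈ Set.Icc (-M) M, g x = f x) ∧ ∀ x, ‖deriv g x‖ ≤ L := by
  have hM' : -M ≤ M := by linarith
  -- Clamping to `[-M, M]`: `f' ∘ c` is continuous and continues `f'` by its boundary values.
  set c : ℝ → ℝ := fun t => Set.projIcc (-M) M hM' t with hc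
  have hcc : Continuous c := continuous_subtype_val.comp continuous_projIcc
  have hd : Continuous (deriv f) := hf.continuous_deriv le_rfl
  have hdc : Continuous fun t => deriv f (c t) := hd.comp hcc
  set g : ℝ → ℂ := fun x => f 0 + ∫ t in (0 : ℝ)..x, deriv f (c t) with hg
  have hgd : ∀ x, HasDerivAt g (deriv f (c x)) x := fun x =>
    (intervalIntegral.integral_hasDerivAt_right (hdc.intervalIntegrable _ _)
      (hdc.stronglyMeasurableAtFilter _ _) hdc.continuousAt).const_add _
  have hgderiv : deriv g = fun x => deriv f (c x) := funext fun x => (hgd x).deriv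
  refine ⟨g, ?_, ?_, ?_⟩
  · rw [contDiff_one_iff_deriv, hgderiv]
    exact ⟨fun x => (hgd x).differentiableAt, hdc⟩
  · intro x hx
    have hsub : Set.uIcc 0 x ⊆ Set.Icc (-M) M :=
      Set.uIcc_subset_Icc ⟨by linarith, hM.le⟩ hx
    have h1 : ∫ t in (0 : ℝ)..x, deriv f (c t) = ∫ t in (0 : ℝ)..x, deriv f t :=
      intervalIntegral.integral_congr fun t ht => by
        simp only [hc]
        rw [Set.projIcc_of_mem hM' (hsub ht)]
    simp only [hg]
    rw [h1, intervalIntegral.integral_deriv_eq_sub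
      (fun t _ => hf.differentiable one_ne_zero t) (hd.intervalIntegrable _ _)]
    ring
  · intro x
    rw [hgderiv]
    exact hL _ (Set.projIcc (-M) M hM' x).2

lemma polyGrowth_of_deriv_le {g : ℝ → ℂ} (hg : ContDiff ℝ 1 g) {L : ℝ} (hL : ∀ x, ‖deriv g x‖ ≤ L) :
    PolyGrowth g := by
  have hL0 : 0 ≤ L := (norm_nonneg _).trans (hL 0)
  refine ⟨‖g 0‖ + L, 1, fun x => ?_⟩
  have h := Convex.norm_image_sub_le_of_norm_deriv_le (f := g) (s := Set.univ) (x := 0) (y := x)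
    (fun t _ => hg.differentiable one_ne_zero t) (fun t _ => hL t) convex_univ trivial trivial
  rw [sub_zero, Real.norm_eq_abs] at h
  have h1 : ‖g x‖ ≤ ‖g 0‖ + L * |x| := by
    have := norm_le_norm_add_norm_sub' (g x) (g 0)
    linarith
  have h2 : |x| ≤ 1 + x ^ 2 := by nlinarith [sq_abs x, sq_nonneg (|x| - 1), abs_nonneg x]
  have h3 : L * |x| ≤ L * (1 + x ^ 2) := mul_le_mul_of_nonneg_left h2 hL0
  rw [mul_one]
  nlinarith [norm_nonneg (g 0), sq_nonneg x, mul_nonneg (norm_nonneg (g 0)) (sq_nonneg x)]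

end Extension

/-! ### Asymptotic variance bound -/

section Truncation

variable {Ω : ℕ → Type u} [∀ N, MeasurableSpace (Ω N)] {P : ∀ N, Measure (Ω N)}
  [∀ N, IsProbabilityMeasure (P N)] {X : SelfAdjointEnsemble Ω} {M K : ℝ}

/-- The statistic vanishes when `‖X_N‖ ≤ M`, because all eigenvalues then lie in `[-M, M]`. On the
remaining event its square is split into a deterministic part, controlled by the small probability,
and a small multiple of an envelope, controlled by moments. -/
lemma tendsto_l2Norm_linStat_of_eq_zero (hX : HasSecondOrderLimitDistribution X P)
    (hA1 : NormTailBound X P M) {h : ℝ → ℂ} (hc : Continuous h) (hg : PolyGrowth h)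
    (h0 : ∀ x ∈ Set.Icc (-M) M, h x = 0) :
    Tendsto (fun N => l2Norm (P N) (X.linStat h N)) atTop (𝓝 0) := by
  obtain ⟨C, m, hC⟩ := id hg
  obtain ⟨A, hA0, hA⟩ := exists_integral_envelope_le hX (2 * (2 * m))
  set p : ℕ → ℝ := fun N => (P N).real {ω | M < ‖Matrix.toEuclideanCLM (𝕜 := ℂ) (X.mat N ω)‖}
    with hp
  have hbound : ∀ N : ℕ, 1 ≤ N → l2Norm (P N) (X.linStat h N) ^ 2 ≤
      C ^ 2 * ((N : ℝ) ^ 8 * p N) + 2 * C ^ 2 * A * (1 / (N : ℝ)) := by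
    intro N hN
    have hN1 : (1 : ℝ) ≤ N := by exact_mod_cast hN
    have hN0 : (0 : ℝ) < N := by linarith
    -- A measurable superset of the same probability makes the indicator integrable.
    set B := toMeasurable (P N) {ω | M < ‖Matrix.toEuclideanCLM (𝕜 := ℂ) (X.mat N ω)‖} with hB
    have hBm : MeasurableSet B := measurableSet_toMeasurable _ _
    have hBp : (P N).real B = p N := by
      simp only [hp, Measure.real, hB, measure_toMeasurable]
    have hpt : ∀ ω, ‖X.linStat h N ω‖ ^ 2 ≤ B.indicator (fun _ => C ^ 2 * (N : ℝ) ^ 5) ω +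
        2 * C ^ 2 / (N : ℝ) ^ 2 * envelope X (2 * (2 * m)) N ω := by
      intro ω
      have he := envelope_nonneg X (2 * (2 * m)) N ω
      by_cases hω : ω ∈ B
      · rw [Set.indicator_of_mem hω]
        have h1 : ‖X.linStat h N ω‖ ^ 2 ≤ C ^ 2 * envelope X m N ω ^ 2 := by
          rw [← mul_pow]
          exact pow_le_pow_left₀ (norm_nonneg _) (norm_linStat_le X hC N ω) 2
        have h2 := envelope_sq_le X m N ω
        have h3 := envelope_sq_le X (2 * m) N ω
        set s := envelope X (2 * m) N ω
        set e := envelope X (2 * (2 * m)) N ω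
        -- From `2 N⁴ s ≤ N⁸ + s²` and `s² ≤ 2 N e`, divided by `N³`. As `E e = O(N)`, the last term
        -- contributes `O(1/N)`, while `N⁵` is absorbed by the tail condition, of which only the
        -- fifth power matters.
        have h4 : 2 * N * s ≤ (N : ℝ) ^ 5 + 2 / (N : ℝ) ^ 2 * e := by
          have h5 : 2 * (N : ℝ) ^ 4 * s ≤ (N : ℝ) ^ 8 + s ^ 2 := by
            nlinarith [sq_nonneg ((N : ℝ) ^ 4 - s)]
          have h6 : 2 * (N : ℝ) ^ 4 * s ≤ (N : ℝ) ^ 8 + 2 * N * e := h5.trans (by linarith)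
          have h7 : (N : ℝ) ^ 5 + 2 / (N : ℝ) ^ 2 * e - 2 * N * s =
              ((N : ℝ) ^ 8 + 2 * N * e - 2 * (N : ℝ) ^ 4 * s) / (N : ℝ) ^ 3 := by
            field_simp
          have h8 : 0 ≤ ((N : ℝ) ^ 8 + 2 * N * e - 2 * (N : ℝ) ^ 4 * s) / (N : ℝ) ^ 3 :=
            div_nonneg (by linarith) (by positivity)
          linarith
        calc ‖X.linStat h N ω‖ ^ 2 ≤ C ^ 2 * envelope X m N ω ^ 2 := h1
          _ ≤ C ^ 2 * ((N : ℝ) ^ 5 + 2 / (N : ℝ) ^ 2 * e) :=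
            mul_le_mul_of_nonneg_left (h2.trans h4) (sq_nonneg C)
          _ = _ := by ring
      · rw [Set.indicator_of_notMem hω, zero_add]
        have hω' : ‖Matrix.toEuclideanCLM (𝕜 := ℂ) (X.mat N ω)‖ ≤ M := by
          by_contra hlt
          exact hω (subset_toMeasurable _ _ (not_le.1 hlt))
        have hz : X.linStat h N ω = 0 := by
          rw [linStat_apply]
          refine Finset.sum_eq_zero fun i _ => h0 _ (abs_le.1 ?_)
          exact (abs_eigenvalues_le_norm _ i).trans hω'
        rw [hz]
        simp only [norm_zero, ne_eq, OfNat.ofNat_ne_zero, not_false_eq_true, zero_pow]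
        positivity
    have hi1 : Integrable (B.indicator fun _ => C ^ 2 * (N : ℝ) ^ 5) (P N) :=
      (integrable_const _).indicator hBm
    have hi2 := (integrable_envelope hX (2 * (2 * m)) N).const_mul (2 * C ^ 2 / (N : ℝ) ^ 2)
    rw [l2Norm_sq (memLp_two_linStat hX hc hg N)]
    calc ∫ ω, ‖X.linStat h N ω‖ ^ 2 ∂(P N)
        ≤ ∫ ω, B.indicator (fun _ => C ^ 2 * (N : ℝ) ^ 5) ω +
            2 * C ^ 2 / (N : ℝ) ^ 2 * envelope X (2 * (2 * m)) N ω ∂(P N) :=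
          integral_mono_of_nonneg (ae_of_all _ fun _ => by positivity) (hi1.add hi2)
            (ae_of_all _ hpt)
      _ = p N * (C ^ 2 * (N : ℝ) ^ 5) +
            2 * C ^ 2 / (N : ℝ) ^ 2 * ∫ ω, envelope X (2 * (2 * m)) N ω ∂(P N) := by
          rw [integral_add hi1 hi2, integral_indicator_const _ hBm, hBp, integral_const_mul,
            smul_eq_mul]
      _ ≤ p N * (C ^ 2 * (N : ℝ) ^ 8) + 2 * C ^ 2 / (N : ℝ) ^ 2 * (A * N) := by
          have hpn : 0 ≤ p N := measureReal_nonneg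
          have h58 : (N : ℝ) ^ 5 ≤ (N : ℝ) ^ 8 := pow_le_pow_right₀ hN1 (by norm_num)
          have := hA N
          gcongr
      _ = _ := by
          field_simp
  have hlim : Tendsto (fun N : ℕ => C ^ 2 * ((N : ℝ) ^ 8 * p N) + 2 * C ^ 2 * A * (1 / (N : ℝ)))
      atTop (𝓝 0) := by
    have h1 : Tendsto (fun N : ℕ => (N : ℝ) ^ 8 * p N) atTop (𝓝 0) := hA1
    have h2 : Tendsto (fun N : ℕ => 1 / (N : ℝ)) atTop (𝓝 0) := tendsto_one_div_atTop_nhds_zero_nat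
    simpa using (h1.const_mul (C ^ 2)).add (h2.const_mul (2 * C ^ 2 * A))
  have hsq : Tendsto (fun N => l2Norm (P N) (X.linStat h N) ^ 2) atTop (𝓝 0) :=
    squeeze_zero' (Eventually.of_forall fun _ => sq_nonneg _)
      ((eventually_ge_atTop 1).mono hbound) hlim
  have := hsq.sqrt
  simpa [Real.sqrt_sq (l2Norm_nonneg _)] using this

lemma stdDev_linStat_le (hK : 0 < K) (hA2 : VarianceBound X P K)
    {g : ℝ → ℂ} (hg : ContDiff ℝ 1 g) {L : ℝ} (hL : ∀ x, ‖deriv g x‖ ≤ L) (N : ℕ) :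
    stdDev (P N) (X.linStat g N) ≤ √K * L := by
  have hL0 : 0 ≤ L := (norm_nonneg _).trans (hL 0)
  have h := hA2 g hg N
  have hsup : (⨆ x : ℝ, ‖deriv g x‖ₑ) ≤ ENNReal.ofReal L := iSup_le fun x => by
    rw [← ofReal_norm]
    exact ENNReal.ofReal_le_ofReal (hL x)
  set Z : Ω N → ℂ := fun ω => X.linStat g N ω - ∫ ω', X.linStat g N ω' ∂(P N) with hZ
  have e : eLpNorm Z 2 (P N) ^ 2 = ∫⁻ ω, ‖Z ω‖ₑ ^ 2 ∂(P N) := by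
    have := eLpNorm_nnreal_pow_eq_lintegral (f := Z) (μ := P N) (p := 2) (by norm_num)
    simpa using this
  have h2 : eLpNorm Z 2 (P N) ^ 2 ≤ ENNReal.ofReal (K * L ^ 2) := by
    rw [e, ENNReal.ofReal_mul hK.le, ENNReal.ofReal_pow hL0]
    exact h.trans (by gcongr)
  have h3 := ENNReal.toReal_mono ENNReal.ofReal_ne_top h2
  rw [ENNReal.toReal_pow, ENNReal.toReal_ofReal (by positivity)] at h3
  refine abs_le_of_sq_le_sq' ?_ (by positivity) |>.2
  rw [mul_pow, Real.sq_sqrt hK.le]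
  exact h3

/-- The variance of a linear statistic is asymptotically controlled by the derivative on
`[-M, M]`. -/
lemma eventually_stdDev_linStat_le (hX : HasSecondOrderLimitDistribution X P) (hM : 0 < M)
    (hA1 : NormTailBound X P M) (hK : 0 < K) (hA2 : VarianceBound X P K)
    {f : ℝ → ℂ} (hf : ContDiff ℝ 1 f) (hfg : PolyGrowth f) {L : ℝ}
    (hL : ∀ x ∈ Set.Icc (-M) M, ‖deriv f x‖ ≤ L) {ε : ℝ} (hε : 0 < ε) :
    ∀ᶠ N in atTop, stdDev (P N) (X.linStat f N) ≤ √K * L + ε := by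
  -- Write `f = g + (f - g)`: the first term falls under (A2), the second is negligible in `L²`.
  obtain ⟨g, hg, hgf, hgL⟩ := exists_extension_deriv_le hf hM hL
  have hgg := polyGrowth_of_deriv_le hg hgL
  have hcd : Continuous (f - g) := hf.continuous.sub hg.continuous
  have ht := tendsto_l2Norm_linStat_of_eq_zero hX hA1 hcd (hfg.sub hgg)
    (fun x hx => by simp [hgf x hx])
  filter_upwards [ht.eventually (gt_mem_nhds (show (0 : ℝ) < ε / 2 by positivity))] with N hN
  have h1 := stdDev_linStat_le hK hA2 hg hgL N
  have hm := memLp_two_linStat hX hcd (hfg.sub hgg) N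
  have h2 := stdDev_le_two_mul_l2Norm hm
  have h3 := stdDev_add_le (memLp_two_linStat hX hg.continuous hgg N) hm
  rw [← linStat_add, add_sub_cancel] at h3
  linarith

end Truncation

end SecondOrder

namespace SecondOrder

/-! ### Polynomial approximation of derivatives -/

section Approximation

lemma exists_polynomial_derivative_eq (q : Polynomial ℝ) :
    ∃ p : Polynomial ℝ, Polynomial.derivative p = q := by
  refine ⟨∑ k ∈ Finset.range (q.natDegree + 1),
    Polynomial.C (q.coeff k / (k + 1)) * Polynomial.X ^ (k + 1), ?_⟩
  conv_rhs => rw [q.as_sum_range_C_mul_X_pow]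
  rw [Polynomial.derivative_sum]
  refine Finset.sum_congr rfl fun k _ => ?_
  rw [Polynomial.derivative_C_mul_X_pow]
  have : (k : ℝ) + 1 ≠ 0 := by positivity
  simp only [Nat.add_sub_cancel, Nat.cast_add, Nat.cast_one]
  rw [div_mul_cancel₀ _ this]

lemma exists_polynomial_derivative_near {g : ℝ → ℝ} (hg : Continuous g) (M : ℝ) {ε : ℝ}
    (hε : 0 < ε) : ∃ p : Polynomial ℝ, ∀ x ∈ Set.Icc (-M) M,
      |g x - (Polynomial.derivative p).eval x| < ε := by
  obtain ⟨q, hq⟩ := exists_polynomial_near_of_continuousOn (-M) M g hg.continuousOn ε hε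
  obtain ⟨p, rfl⟩ := exists_polynomial_derivative_eq q
  exact ⟨p, fun x hx => by rw [abs_sub_comm]; exact hq x hx⟩

lemma hasDerivAt_polynomial_ofReal (p : Polynomial ℂ) (x : ℝ) :
    HasDerivAt (fun x : ℝ => p.eval (x : ℂ)) ((Polynomial.derivative p).eval (x : ℂ)) x :=
  (p.hasDerivAt (x : ℂ)).comp_ofReal

lemma contDiff_polynomial_ofReal (p : Polynomial ℂ) :
    ContDiff ℝ 1 fun x : ℝ => p.eval (x : ℂ) := by
  rw [polynomial_eq_sum]
  exact C1.sum_mem fun k _ => C1.smul_mem (p.coeff k) (monomial k).2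

/-- Weierstrass for the real and imaginary parts of `f'`, up to `ε / 2` each, followed by taking a
primitive. Closeness of the functions themselves is not needed, since only derivatives enter the
variance bound. -/
lemma exists_polynomial_deriv_near {f : ℝ → ℂ} (hf : ContDiff ℝ 1 f) (M : ℝ) {ε : ℝ}
    (hε : 0 < ε) : ∃ p : Polynomial ℂ, ∀ x ∈ Set.Icc (-M) M,
      ‖deriv (f - fun x : ℝ => p.eval (x : ℂ)) x‖ ≤ ε := by
  have hd : Continuous (deriv f) := hf.continuous_deriv le_rfl
  obtain ⟨p, hp⟩ := exists_polynomial_derivative_near (Complex.continuous_re.comp hd) M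
    (half_pos hε)
  obtain ⟨q, hq⟩ := exists_polynomial_derivative_near (Complex.continuous_im.comp hd) M
    (half_pos hε)
  refine ⟨p.map Complex.ofRealHom + Polynomial.C Complex.I * q.map Complex.ofRealHom,
    fun x hx => ?_⟩
  rw [deriv_sub (hf.differentiable one_ne_zero x) (hasDerivAt_polynomial_ofReal _ x).differentiableAt,
    (hasDerivAt_polynomial_ofReal _ x).deriv]
  have e : ∀ r : Polynomial ℝ, (r.map Complex.ofRealHom).eval (x : ℂ) = ((r.eval x : ℝ) : ℂ) := fun r =>
    Polynomial.eval_map_apply (f := Complex.ofRealHom) (p := r) x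
  simp only [Polynomial.derivative_add, Polynomial.derivative_mul, Polynomial.derivative_C,
    zero_mul, zero_add, Polynomial.derivative_map, Polynomial.eval_add, Polynomial.eval_mul,
    Polynomial.eval_C, e]
  refine (Complex.norm_le_abs_re_add_abs_im _).trans ?_
  have h1 := hp x hx
  have h2 := hq x hx
  simp only [Function.comp] at h1 h2
  simp
  linarith

lemma bddAbove_norm_Icc {h : ℝ → ℂ} (hc : Continuous h) (M : ℝ) :
    BddAbove (Set.range fun x : Set.Icc (-M) M => ‖h x‖) := by
  have := (isCompact_Icc (a := -M) (b := M)).bddAbove_image (f := fun x => ‖h x‖)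
    hc.norm.continuousOn
  refine this.mono ?_
  rintro _ ⟨x, rfl⟩
  exact ⟨x, x.2, rfl⟩

lemma norm_le_supNormOn {h : ℝ → ℂ} (hc : Continuous h) {M x : ℝ} (hx : x ∈ Set.Icc (-M) M) :
    ‖h x‖ ≤ supNormOn M h :=
  le_ciSup (bddAbove_norm_Icc hc M) (⟨x, hx⟩ : Set.Icc (-M) M)

lemma supNormOn_nonneg (M : ℝ) (h : ℝ → ℂ) : 0 ≤ supNormOn M h :=
  Real.iSup_nonneg fun _ => norm_nonneg _

lemma supNormOn_le {h : ℝ → ℂ} {M ε : ℝ} (hε : 0 ≤ ε) (hx : ∀ x ∈ Set.Icc (-M) M, ‖h x‖ ≤ ε) :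
    supNormOn M h ≤ ε :=
  Real.iSup_le (fun x => hx x x.2) hε

lemma supNormOn_congr {g h : ℝ → ℂ} {M : ℝ} (hx : ∀ x ∈ Set.Icc (-M) M, g x = h x) :
    supNormOn M g = supNormOn M h := by
  unfold supNormOn
  congr 1
  funext x
  rw [hx x x.2]

/-- Clear in the open interval, and at the endpoints by continuity of the derivatives. Hence
`‖f'‖_M` depends only on the restriction of `f`. -/
lemma deriv_eq_of_eqOn_Icc {f g : ℝ → ℂ} (hf : ContDiff ℝ 1 f) (hg : ContDiff ℝ 1 g) {M : ℝ}
    (hM : 0 < M) (h : ∀ x ∈ Set.Icc (-M) M, f x = g x) :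
    ∀ x ∈ Set.Icc (-M) M, deriv f x = deriv g x := by
  have hcl : IsClosed {x | deriv f x = deriv g x} :=
    isClosed_eq (hf.continuous_deriv le_rfl) (hg.continuous_deriv le_rfl)
  have hsub : Set.Ioo (-M) M ⊆ {x | deriv f x = deriv g x} := fun x hx => by
    refine Filter.EventuallyEq.deriv_eq ?_
    filter_upwards [Icc_mem_nhds hx.1 hx.2] with y hy using h y hy
  have := hcl.closure_subset_iff.2 hsub
  rw [closure_Ioo (by linarith : -M ≠ M)] at this
  exact fun x hx => this hx

end Approximation

/-! ### The limiting covariance form -/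

section LimitForm

/-- The `C¹` functions dominated by a polynomial. -/
def growthC1 : Submodule ℂ (ℝ → ℂ) where
  carrier := {f | ContDiff ℝ 1 f ∧ PolyGrowth f}
  add_mem' hf hg := ⟨C1.add_mem hf.1 hg.1, hf.2.add hg.2⟩
  zero_mem' := ⟨C1.zero_mem, polyGrowth_zero⟩
  smul_mem' c _ hf := ⟨C1.smul_mem c hf.1, hf.2.smul c⟩

lemma growthC1.continuous (f : growthC1) : Continuous (f : ℝ → ℂ) := f.2.1.continuous

lemma growthC1.continuous_deriv (f : growthC1) : Continuous (deriv (f : ℝ → ℂ)) :=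
  f.2.1.continuous_deriv le_rfl

/-- A polynomial as an element of `growthC1`. -/
def polyGrowthC1 (p : Polynomial ℂ) : growthC1 :=
  ⟨fun x : ℝ => p.eval (x : ℂ), contDiff_polynomial_ofReal p, polyGrowth_polynomial p⟩

/-- A monomial as an element of `growthC1`. -/
def powGrowthC1 (n : ℕ) : growthC1 :=
  ⟨fun x : ℝ => (x : ℂ) ^ n, (monomial n).2, polyGrowth_pow n⟩

lemma polyGrowthC1_eq_sum (p : Polynomial ℂ) : polyGrowthC1 p =
    ∑ k ∈ Finset.range (p.natDegree + 1), p.coeff k • powGrowthC1 k := by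
  refine Subtype.ext ?_
  simp only [polyGrowthC1, polynomial_eq_sum, Submodule.coe_sum, Submodule.coe_smul, powGrowthC1]

lemma exists_tendsto_of_approx {u : ℕ → ℂ}
    (h : ∀ ε > 0, ∃ (v : ℕ → ℂ) (a : ℂ), Tendsto v atTop (𝓝 a) ∧ ∀ᶠ N in atTop, ‖u N - v N‖ ≤ ε) :
    ∃ a, Tendsto u atTop (𝓝 a) := by
  refine cauchySeq_tendsto_of_complete (Metric.cauchySeq_iff'.2 fun ε hε => ?_)
  obtain ⟨v, a, hv, huv⟩ := h (ε / 5) (by positivity)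
  obtain ⟨N₀, hN₀⟩ := eventually_atTop.1 (huv.and (Metric.tendsto_nhds.1 hv (ε / 5) (by positivity)))
  refine ⟨N₀, fun n hn => ?_⟩
  obtain ⟨h1, h2⟩ := hN₀ n hn
  obtain ⟨h3, h4⟩ := hN₀ N₀ le_rfl
  rw [← dist_eq_norm] at h1 h3
  rw [dist_comm] at h4 h3
  calc dist (u n) (u N₀) ≤ dist (u n) (v n) + dist (v n) a + dist a (v N₀) + dist (v N₀) (u N₀) :=
        (dist_triangle4 _ a _ _).trans (by linarith [dist_triangle (u n) (v n) a])
    _ < ε := by linarith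

variable {Ω : ℕ → Type u} [∀ N, MeasurableSpace (Ω N)] {P : ∀ N, Measure (Ω N)}
  [∀ N, IsProbabilityMeasure (P N)] {X : SelfAdjointEnsemble Ω} {M K : ℝ}

lemma memLp_two_growthC1 (hX : HasSecondOrderLimitDistribution X P) (f : growthC1) (N : ℕ) :
    MemLp (X.linStat (f : ℝ → ℂ) N) 2 (P N) :=
  memLp_two_linStat hX (growthC1.continuous f) f.2.2 N

/-- The covariance of linear statistics as a bilinear form. -/
noncomputable def covForm (hX : HasSecondOrderLimitDistribution X P) (N : ℕ) : growthC1 →ₗ[ℂ] growthC1 →ₗ[ℂ] ℂ :=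
  LinearMap.mk₂ ℂ (fun f g => cov (P N) (X.linStat (f : ℝ → ℂ) N) (X.linStat (g : ℝ → ℂ) N))
    (fun f f' g => by
      rw [Submodule.coe_add, linStat_add]
      exact cov_add_left (memLp_two_growthC1 hX f N) (memLp_two_growthC1 hX f' N)
        (memLp_two_growthC1 hX g N))
    (fun c f g => by rw [Submodule.coe_smul, linStat_smul, cov_smul_left, smul_eq_mul])
    (fun f g g' => by
      rw [Submodule.coe_add, linStat_add]
      exact cov_add_right (memLp_two_growthC1 hX g N) (memLp_two_growthC1 hX g' N)
        (memLp_two_growthC1 hX f N))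
    (fun c f g => by rw [Submodule.coe_smul, linStat_smul, cov_smul_right, smul_eq_mul])

lemma covForm_apply (hX : HasSecondOrderLimitDistribution X P) (N : ℕ) (f g : growthC1) :
    covForm hX N f g = cov (P N) (X.linStat (f : ℝ → ℂ) N) (X.linStat (g : ℝ → ℂ) N) := rfl

lemma covForm_comm (hX : HasSecondOrderLimitDistribution X P) (N : ℕ) (f g : growthC1) :
    covForm hX N f g = covForm hX N g f := cov_comm _ _

lemma norm_covForm_le (hX : HasSecondOrderLimitDistribution X P) (N : ℕ) (f g : growthC1) :
    ‖covForm hX N f g‖ ≤ stdDev (P N) (X.linStat (f : ℝ → ℂ) N) *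
      stdDev (P N) (X.linStat (g : ℝ → ℂ) N) :=
  norm_cov_le (memLp_two_growthC1 hX f N) (memLp_two_growthC1 hX g N)

lemma exists_tendsto_covForm_pow (hX : HasSecondOrderLimitDistribution X P) (m n : ℕ) :
    ∃ a, Tendsto (fun N => covForm hX N (powGrowthC1 m) (powGrowthC1 n)) atTop (𝓝 a) := by
  obtain ⟨a, ha⟩ := hX.cov_tendsto m n
  exact ⟨a, ha.congr fun N => by rw [covForm_apply, trPow_eq, trPow_eq]; rfl⟩

lemma exists_tendsto_covForm_polynomial (hX : HasSecondOrderLimitDistribution X P)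
    (p q : Polynomial ℂ) :
    ∃ a, Tendsto (fun N => covForm hX N (polyGrowthC1 p) (polyGrowthC1 q)) atTop (𝓝 a) := by
  choose a ha using exists_tendsto_covForm_pow hX
  refine ⟨∑ k ∈ Finset.range (p.natDegree + 1), ∑ l ∈ Finset.range (q.natDegree + 1),
    p.coeff k * (q.coeff l * a k l), ?_⟩
  simp only [polyGrowthC1_eq_sum, map_sum, map_smul, LinearMap.sum_apply, LinearMap.smul_apply,
    smul_eq_mul, Finset.mul_sum]
  simp_rw [← mul_assoc]
  rw [Finset.sum_comm]
  refine tendsto_finsetSum _ fun l _ => tendsto_finsetSum _ fun k _ => ?_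
  simpa [mul_comm, mul_left_comm, mul_assoc] using (ha k l).const_mul (p.coeff k * q.coeff l)

lemma eventually_stdDev_growthC1_le (hX : HasSecondOrderLimitDistribution X P) (hM : 0 < M)
    (hA1 : NormTailBound X P M) (hK : 0 < K) (hA2 : VarianceBound X P K) (f : growthC1)
    {ε : ℝ} (hε : 0 < ε) :
    ∀ᶠ N in atTop, stdDev (P N) (X.linStat (f : ℝ → ℂ) N) ≤
      √K * supNormOn M (deriv (f : ℝ → ℂ)) + ε :=
  eventually_stdDev_linStat_le hX hM hA1 hK hA2 f.2.1 f.2.2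
    (fun _ hx => norm_le_supNormOn (growthC1.continuous_deriv f) hx) hε

lemma exists_polynomial_stdDev_le (hX : HasSecondOrderLimitDistribution X P) (hM : 0 < M)
    (hA1 : NormTailBound X P M) (hK : 0 < K) (hA2 : VarianceBound X P K) (f : growthC1)
    {ε : ℝ} (hε : 0 < ε) :
    ∃ p : Polynomial ℂ, ∀ᶠ N in atTop,
      stdDev (P N) (X.linStat ((f - polyGrowthC1 p : growthC1) : ℝ → ℂ) N) ≤ ε := by
  have hK' : 0 < √K := Real.sqrt_pos.2 hK
  -- Chosen so that `√K · ε / (2√K) + ε / 2 = ε`.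
  obtain ⟨p, hp⟩ := exists_polynomial_deriv_near f.2.1 M (show 0 < ε / (2 * √K) by positivity)
  refine ⟨p, ?_⟩
  have h := eventually_stdDev_linStat_le hX hM hA1 hK hA2 (f - polyGrowthC1 p : growthC1).2.1
    (f - polyGrowthC1 p : growthC1).2.2 hp (half_pos hε)
  filter_upwards [h] with N hN
  refine hN.trans (le_of_eq ?_)
  field_simp
  ring

/-- Density in one argument, the other being fixed; by symmetry of the covariance two applications
pass from polynomials to all pairs. -/
lemma exists_tendsto_covForm_of_approx (hX : HasSecondOrderLimitDistribution X P) (hM : 0 < M)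
    (hA1 : NormTailBound X P M) (hK : 0 < K) (hA2 : VarianceBound X P K) (f g : growthC1)
    (h : ∀ p, ∃ a, Tendsto (fun N => covForm hX N (polyGrowthC1 p) g) atTop (𝓝 a)) :
    ∃ a, Tendsto (fun N => covForm hX N f g) atTop (𝓝 a) := by
  refine exists_tendsto_of_approx fun ε hε => ?_
  set D := √K * supNormOn M (deriv (g : ℝ → ℂ)) + 1 with hD
  have hD0 : 0 < D := by
    have := supNormOn_nonneg M (deriv (g : ℝ → ℂ))
    positivity
  obtain ⟨p, hp⟩ := exists_polynomial_stdDev_le hX hM hA1 hK hA2 f (show 0 < ε / D by positivity)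
  obtain ⟨a, ha⟩ := h p
  refine ⟨_, a, ha, ?_⟩
  filter_upwards [hp, eventually_stdDev_growthC1_le hX hM hA1 hK hA2 g one_pos] with N h1 h2
  rw [← LinearMap.sub_apply, ← map_sub]
  calc _ ≤ _ := norm_covForm_le hX N _ _
    _ ≤ ε / D * D := mul_le_mul h1 h2 (stdDev_nonneg _) (by positivity)
    _ = ε := div_mul_cancel₀ _ hD0.ne'

lemma exists_tendsto_covForm (hX : HasSecondOrderLimitDistribution X P) (hM : 0 < M)
    (hA1 : NormTailBound X P M) (hK : 0 < K) (hA2 : VarianceBound X P K) (f g : growthC1) :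
    ∃ a, Tendsto (fun N => covForm hX N f g) atTop (𝓝 a) := by
  refine exists_tendsto_covForm_of_approx hX hM hA1 hK hA2 f g fun p => ?_
  simp_rw [covForm_comm hX _ (polyGrowthC1 p) g]
  exact exists_tendsto_covForm_of_approx hX hM hA1 hK hA2 g _ fun q =>
    exists_tendsto_covForm_polynomial hX q p

/-- The asymptotic covariance form exists, and is bounded by the derivatives on `[-M, M]`. -/
lemma exists_limitForm (hX : HasSecondOrderLimitDistribution X P) (hM : 0 < M)
    (hA1 : NormTailBound X P M) (hK : 0 < K) (hA2 : VarianceBound X P K) :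
    ∃ B : growthC1 →ₗ[ℂ] growthC1 →ₗ[ℂ] ℂ,
      (∀ f g, Tendsto (fun N => covForm hX N f g) atTop (𝓝 (B f g))) ∧
      ∀ f g : growthC1, ‖B f g‖ ≤
        K * supNormOn M (deriv (f : ℝ → ℂ)) * supNormOn M (deriv (g : ℝ → ℂ)) := by
  choose b hb using exists_tendsto_covForm hX hM hA1 hK hA2
  -- Bilinearity passes to the limit by uniqueness of limits.
  refine ⟨LinearMap.mk₂ ℂ b (fun f f' g => ?_) (fun c f g => ?_) (fun f g g' => ?_)
    (fun c f g => ?_), hb, fun f g => ?_⟩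
  · refine tendsto_nhds_unique (hb _ _) (((hb f g).add (hb f' g)).congr fun N => ?_)
    rw [map_add, LinearMap.add_apply]
  · refine tendsto_nhds_unique (hb _ _) (((hb f g).const_smul c).congr fun N => ?_)
    rw [map_smul, LinearMap.smul_apply]
  · refine tendsto_nhds_unique (hb _ _) (((hb f g).add (hb f g')).congr fun N => ?_)
    rw [map_add]
  · refine tendsto_nhds_unique (hb _ _) (((hb f g).const_smul c).congr fun N => ?_)
    rw [map_smul]
  · set F := supNormOn M (deriv (f : ℝ → ℂ)) with hF
    set G := supNormOn M (deriv (g : ℝ → ℂ)) with hG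
    have hF0 : 0 ≤ F := supNormOn_nonneg _ _
    have hle : ∀ ε : ℝ, 0 < ε → ‖b f g‖ ≤ (√K * F + ε) * (√K * G + ε) := fun ε hε => by
      refine le_of_tendsto (hb f g).norm ?_
      filter_upwards [eventually_stdDev_growthC1_le hX hM hA1 hK hA2 f hε,
        eventually_stdDev_growthC1_le hX hM hA1 hK hA2 g hε] with N h1 h2
      exact (norm_covForm_le hX N f g).trans
        (mul_le_mul h1 h2 (stdDev_nonneg _) (by positivity))
    -- Letting `ε` decrease to 0 recovers the sharp constant `K`.
    have hcont : Tendsto (fun ε : ℝ => (√K * F + ε) * (√K * G + ε)) (𝓝[>] 0)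
        (𝓝 ((√K * F + 0) * (√K * G + 0))) := by
      have : Continuous fun ε : ℝ => (√K * F + ε) * (√K * G + ε) := by fun_prop
      exact (this.tendsto 0).mono_left nhdsWithin_le_nhds
    have h := ge_of_tendsto hcont (eventually_mem_nhdsWithin.mono fun ε hε => hle ε hε)
    refine h.trans (le_of_eq ?_)
    have := Real.mul_self_sqrt hK.le
    calc (√K * F + 0) * (√K * G + 0) = (√K * √K) * F * G := by ring
      _ = K * F * G := by rw [this]

end LimitForm

/-! ### Descent to `C¹([-M, M])` and uniqueness -/

section Restriction

/-- The restriction map `C¹(ℝ) → C¹([-M, M])` as a linear map. -/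
def restrictₗ (M : ℝ) : C1 →ₗ[ℂ] C1On M where
  toFun := restrict M
  map_add' _ _ := rfl
  map_smul' _ _ := rfl

lemma restrictₗ_apply (M : ℝ) (f : C1) : restrictₗ M f = restrict M f := rfl

lemma restrict_surjective (M : ℝ) : Function.Surjective (restrict M) := by
  rintro ⟨h, f, hf, rfl⟩
  exact ⟨⟨f, hf⟩, rfl⟩

lemma restrict_eq_iff {M : ℝ} {f g : C1} :
    restrict M f = restrict M g ↔ ∀ x ∈ Set.Icc (-M) M, (f : ℝ → ℂ) x = (g : ℝ → ℂ) x := by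
  constructor
  · intro h x hx
    exact congrFun (congrArg Subtype.val h) ⟨x, hx⟩
  · intro h
    exact Subtype.ext (funext fun x => h x x.2)

/-- The inclusion of `growthC1` in `C¹(ℝ)`. -/
def growthToC1 : growthC1 →ₗ[ℂ] C1 := Submodule.inclusion fun _ hf => hf.1

lemma coe_growthToC1 (f : growthC1) : (growthToC1 f : ℝ → ℂ) = f := rfl

/-- Polynomially bounded functions already fill `C¹([-M, M])`: the extension with bounded derivative
grows at most linearly. -/
lemma exists_growthC1_restrict_eq {M : ℝ} (hM : 0 < M) (f : C1) :
    ∃ g : growthC1, restrict M (growthToC1 g) = restrict M f := by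
  have hf : ContDiff ℝ 1 (f : ℝ → ℂ) := f.2
  obtain ⟨g, hg, hgf, hgL⟩ := exists_extension_deriv_le hf hM
    fun x hx => norm_le_supNormOn (hf.continuous_deriv le_rfl) hx
  exact ⟨⟨g, hg, polyGrowth_of_deriv_le hg hgL⟩, restrict_eq_iff.2 hgf⟩

lemma supNormOn_deriv_eq_of_restrict_eq {M : ℝ} (hM : 0 < M) {f g : C1}
    (h : restrict M f = restrict M g) :
    supNormOn M (deriv (f : ℝ → ℂ)) = supNormOn M (deriv (g : ℝ → ℂ)) :=
  supNormOn_congr (deriv_eq_of_eqOn_Icc f.2 g.2 hM (restrict_eq_iff.1 h))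

/-- A bilinear form on `growthC1` which is controlled by the derivatives on `[-M, M]` descends to
`C¹([-M, M])`. -/
lemma exists_descent {M K : ℝ} (hM : 0 < M) (B : growthC1 →ₗ[ℂ] growthC1 →ₗ[ℂ] ℂ)
    (hB : ∀ f g : growthC1, ‖B f g‖ ≤
        K * supNormOn M (deriv (f : ℝ → ℂ)) * supNormOn M (deriv (g : ℝ → ℂ))) :
    ∃ ρ : C1On M →ₗ[ℂ] C1On M →ₗ[ℂ] ℂ, ∀ f g : growthC1,
      ρ (restrict M (growthToC1 f)) (restrict M (growthToC1 g)) = B f g := by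
  set R : growthC1 →ₗ[ℂ] C1On M := (restrictₗ M).comp growthToC1 with hR
  have hsurj : Function.Surjective R := fun h => by
    obtain ⟨f, rfl⟩ := restrict_surjective M h
    exact exists_growthC1_restrict_eq hM f
  -- Any linear section of the restriction will do: two lifts differ by a function whose derivative
  -- vanishes on `[-M, M]`, and `B` vanishes as soon as one argument is such a function.
  obtain ⟨s, hs⟩ := R.exists_rightInverse_of_surjective (LinearMap.range_eq_top.2 hsurj)
  have hzero : ∀ f : growthC1, R f = 0 → supNormOn M (deriv (f : ℝ → ℂ)) = 0 := fun f hf => by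
    have h1 : restrict M (growthToC1 f) = restrict M 0 := hf
    rw [← coe_growthToC1, supNormOn_deriv_eq_of_restrict_eq hM h1]
    refine le_antisymm (supNormOn_le le_rfl fun x _ => ?_) (supNormOn_nonneg _ _)
    simp
  have hker : ∀ f : growthC1, R (s (R f) - f) = 0 := fun f => by
    rw [map_sub, sub_eq_zero]
    exact LinearMap.congr_fun hs (R f)
  refine ⟨B.compl₁₂ s s, fun f g => ?_⟩
  have h1 : ∀ g', B (s (R f)) g' = B f g' := fun g' => by
    rw [← sub_eq_zero, ← LinearMap.sub_apply, ← map_sub, ← norm_le_zero_iff]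
    refine (hB _ _).trans (le_of_eq ?_)
    rw [hzero _ (hker f)]
    ring
  have h2 : ∀ f', B f' (s (R g)) = B f' g := fun f' => by
    rw [← sub_eq_zero, ← map_sub, ← norm_le_zero_iff]
    refine (hB _ _).trans (le_of_eq ?_)
    rw [hzero _ (hker g)]
    ring
  rw [LinearMap.compl₁₂_apply]
  exact (h1 _).trans (h2 _)

/-- A bilinear form on `C¹([-M, M])` controlled by the derivatives is determined by its values at
monomials. -/
lemma eq_zero_of_monomial_eq_zero {M C : ℝ} {D : C1On M →ₗ[ℂ] C1On M →ₗ[ℂ] ℂ}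
    (hD : ∀ f g : C1, ‖D (restrict M f) (restrict M g)‖ ≤
      C * supNormOn M (deriv (f : ℝ → ℂ)) * supNormOn M (deriv (g : ℝ → ℂ)))
    (h0 : ∀ m n, D (restrict M (monomial m)) (restrict M (monomial n)) = 0) : D = 0 := by
  set poly : Polynomial ℂ → C1 := fun p => growthToC1 (polyGrowthC1 p) with hpoly
  have hsum : ∀ p, restrict M (poly p) =
      ∑ k ∈ Finset.range (p.natDegree + 1), p.coeff k • restrict M (monomial k) := fun p => by
    simp only [hpoly, polyGrowthC1_eq_sum, map_sum, map_smul, ← restrictₗ_apply]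
    rfl
  have happrox : ∀ (f : C1) (ε : ℝ), 0 < ε → ∃ p,
      supNormOn M (deriv ((f - poly p : C1) : ℝ → ℂ)) ≤ ε := fun f ε hε => by
    obtain ⟨p, hp⟩ := exists_polynomial_deriv_near f.2 M hε
    exact ⟨p, supNormOn_le hε.le hp⟩
  have hsmall : ∀ (z : ℂ) (A : ℝ), 0 ≤ A → (∀ ε : ℝ, 0 < ε → ‖z‖ ≤ A * ε) → z = 0 := by
    intro z A hA h
    by_contra hz
    have hz' : 0 < ‖z‖ := norm_pos_iff.2 hz
    have := h (‖z‖ / (2 * (A + 1))) (by positivity)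
    have h2 : A * (‖z‖ / (2 * (A + 1))) ≤ ‖z‖ / 2 := by
      rw [mul_div_assoc', div_le_div_iff₀ (by positivity) (by positivity)]
      nlinarith
    linarith
  have hD' : ∀ f g : C1, ‖D (restrict M f) (restrict M g)‖ ≤
      |C| * supNormOn M (deriv (f : ℝ → ℂ)) * supNormOn M (deriv (g : ℝ → ℂ)) := fun f g =>
    (hD f g).trans (by
      have := supNormOn_nonneg M (deriv (f : ℝ → ℂ))
      have := supNormOn_nonneg M (deriv (g : ℝ → ℂ))
      gcongr
      exact le_abs_self C)
  have hpp : ∀ p q, D (restrict M (poly p)) (restrict M (poly q)) = 0 := fun p q => by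
    rw [hsum, hsum]
    simp [h0]
  -- The arguments are approximated one at a time, so that the other factor in the bound stays
  -- fixed.
  have hfp : ∀ f q, D (restrict M f) (restrict M (poly q)) = 0 := fun f q => by
    refine hsmall _ (|C| * supNormOn M (deriv (poly q : ℝ → ℂ)))
      (mul_nonneg (abs_nonneg C) (supNormOn_nonneg _ _)) fun ε hε => ?_
    obtain ⟨p, hp⟩ := happrox f ε hε
    have e : D (restrict M f) (restrict M (poly q)) =
        D (restrict M (f - poly p)) (restrict M (poly q)) := by
      rw [← restrictₗ_apply, ← restrictₗ_apply, ← restrictₗ_apply, map_sub, map_sub,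
        LinearMap.sub_apply, restrictₗ_apply, restrictₗ_apply, restrictₗ_apply, hpp, sub_zero]
    rw [e]
    refine (hD' _ _).trans ?_
    have := supNormOn_nonneg M (deriv (poly q : ℝ → ℂ))
    calc _ ≤ |C| * ε * supNormOn M (deriv (poly q : ℝ → ℂ)) := by gcongr
      _ = _ := by ring
  refine LinearMap.ext fun a => LinearMap.ext fun b => ?_
  obtain ⟨f, rfl⟩ := restrict_surjective M a
  obtain ⟨g, rfl⟩ := restrict_surjective M b
  refine hsmall _ (|C| * supNormOn M (deriv (f : ℝ → ℂ)))
      (mul_nonneg (abs_nonneg C) (supNormOn_nonneg _ _)) fun ε hε => ?_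
  obtain ⟨q, hq⟩ := happrox g ε hε
  have e : D (restrict M f) (restrict M g) =
      D (restrict M f) (restrict M (g - poly q)) := by
    rw [← restrictₗ_apply M (g - poly q), map_sub, map_sub, restrictₗ_apply, restrictₗ_apply, hfp,
      sub_zero]
  rw [e]
  refine (hD' _ _).trans ?_
  have := supNormOn_nonneg M (deriv (f : ℝ → ℂ))
  gcongr

variable {Ω : ℕ → Type u} [∀ N, MeasurableSpace (Ω N)] {P : ∀ N, Measure (Ω N)}
  {X : SelfAdjointEnsemble Ω} {M K : ℝ}

lemma IsCovarianceExtension.unique {ρ ρ' : C1On M →ₗ[ℂ] C1On M →ₗ[ℂ] ℂ}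
    (h : IsCovarianceExtension X P M K ρ) (h' : IsCovarianceExtension X P M K ρ') : ρ' = ρ := by
  -- The difference of two extensions is bounded with constant `K + K`.
  refine sub_eq_zero.1 (eq_zero_of_monomial_eq_zero (C := 2 * K) (fun f g => ?_) fun m n => ?_)
  · rw [LinearMap.sub_apply, LinearMap.sub_apply]
    refine (norm_sub_le _ _).trans ?_
    linarith [h.bound f g, h'.bound f g]
  · rw [LinearMap.sub_apply, LinearMap.sub_apply, sub_eq_zero]
    exact tendsto_nhds_unique (h'.extend m n) (h.extend m n)

lemma isCovarianceExtension_of_limitForm [∀ N, IsProbabilityMeasure (P N)]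
    (hX : HasSecondOrderLimitDistribution X P) (hM : 0 < M)
    {B : growthC1 →ₗ[ℂ] growthC1 →ₗ[ℂ] ℂ}
    (hlim : ∀ f g, Tendsto (fun N => covForm hX N f g) atTop (𝓝 (B f g)))
    (hB : ∀ f g : growthC1, ‖B f g‖ ≤
        K * supNormOn M (deriv (f : ℝ → ℂ)) * supNormOn M (deriv (g : ℝ → ℂ)))
    {ρ : C1On M →ₗ[ℂ] C1On M →ₗ[ℂ] ℂ} (hρ : ∀ f g : growthC1,
      ρ (restrict M (growthToC1 f)) (restrict M (growthToC1 g)) = B f g) :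
    IsCovarianceExtension X P M K ρ where
  extend m n := by
    have h := hlim (powGrowthC1 m) (powGrowthC1 n)
    rw [← hρ] at h
    refine h.congr fun N => ?_
    rw [covForm_apply, trPow_eq, trPow_eq]
    rfl
  bound f g := by
    obtain ⟨f', hf'⟩ := exists_growthC1_restrict_eq hM f
    obtain ⟨g', hg'⟩ := exists_growthC1_restrict_eq hM g
    rw [← hf', ← hg', hρ, ← supNormOn_deriv_eq_of_restrict_eq hM hf',
      ← supNormOn_deriv_eq_of_restrict_eq hM hg']
    exact hB f' g'

end Restriction

end SecondOrder

namespace SecondOrder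

/-! ### Cumulants and the central limit theorem for polynomials -/

section Cumulants

variable {Ω : ℕ → Type u} [∀ N, MeasurableSpace (Ω N)] {P : ∀ N, Measure (Ω N)}
  [∀ N, IsProbabilityMeasure (P N)] {X : SelfAdjointEnsemble Ω}

/-- The index `i` lies in exactly one block, so the product depends on the `i`-th argument through a
single integral. Here `H` collects the rest of that block and `c` the other blocks; multilinearity
of the cumulant follows. -/
lemma exists_prod_integral_update_eq (hX : HasSecondOrderLimitDistribution X P) (N : ℕ) {r : ℕ}
    (π : Finpartition (Finset.univ : Finset (Fin r))) (f : Fin r → growthC1) (i : Fin r) :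
    ∃ (H : Ω N → ℂ) (c : ℂ),
      (∀ x : growthC1, Integrable (fun ω => X.linStat (x : ℝ → ℂ) N ω * H ω) (P N)) ∧
      ∀ x : growthC1, ∏ B ∈ π.parts,
        ∫ ω, ∏ j ∈ B, X.linStat (Function.update f i x j : ℝ → ℂ) N ω ∂(P N) =
        c * ∫ ω, X.linStat (x : ℝ → ℂ) N ω * H ω ∂(P N) := by
  have hi : i ∈ π.part i := π.mem_part_self.2 (Finset.mem_univ i)
  have hB : π.part i ∈ π.parts := π.part_mem.2 (Finset.mem_univ i)
  have hpart : ∀ (x : growthC1) (ω : Ω N), X.linStat (x : ℝ → ℂ) N ω *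
      ∏ j ∈ (π.part i).erase i, X.linStat (f j : ℝ → ℂ) N ω =
      ∏ j ∈ π.part i, X.linStat (Function.update f i x j : ℝ → ℂ) N ω := fun x ω => by
    rw [← Finset.mul_prod_erase _ _ hi, Function.update_self]
    congr 1
    refine Finset.prod_congr rfl fun j hj => ?_
    rw [Function.update_of_ne (Finset.ne_of_mem_erase hj)]
  refine ⟨fun ω => ∏ j ∈ (π.part i).erase i, X.linStat (f j : ℝ → ℂ) N ω,
    ∏ B ∈ π.parts.erase (π.part i), ∫ ω, ∏ j ∈ B, X.linStat (f j : ℝ → ℂ) N ω ∂(P N),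
    fun x => ?_, fun x => ?_⟩
  · simp_rw [hpart]
    exact integrable_prod_linStat hX _ (fun j _ => growthC1.continuous _) (fun j _ => (Function.update f i x j).2.2) N
  · rw [← Finset.mul_prod_erase _ _ hB, mul_comm]
    simp_rw [hpart]
    congr 1
    refine Finset.prod_congr rfl fun B hB' => ?_
    congr 1
    funext ω
    refine Finset.prod_congr rfl fun j hj => ?_
    rw [Function.update_of_ne]
    rintro rfl
    exact Finset.ne_of_mem_erase hB' (π.part_eq_of_mem (Finset.mem_of_mem_erase hB') hj).symm

/-- The joint cumulant of linear statistics as a multilinear form. -/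
noncomputable def cumulantForm (hX : HasSecondOrderLimitDistribution X P) (N r : ℕ) :
    MultilinearMap ℂ (fun _ : Fin r => growthC1) ℂ :=
  MultilinearMap.mk' (fun f => cumulant (P N) fun i => X.linStat (f i : ℝ → ℂ) N)
    (fun f i x y => by
      unfold cumulant
      rw [← Finset.sum_add_distrib]
      refine Finset.sum_congr rfl fun π _ => ?_
      obtain ⟨H, c, hi, hc⟩ := exists_prod_integral_update_eq hX N π f i
      rw [hc, hc, hc, Submodule.coe_add, linStat_add]
      simp only [Pi.add_apply, add_mul]
      rw [integral_add (hi x) (hi y)]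
      ring)
    (fun f i a x => by
      unfold cumulant
      rw [smul_eq_mul, Finset.mul_sum]
      refine Finset.sum_congr rfl fun π _ => ?_
      obtain ⟨H, c, hi, hc⟩ := exists_prod_integral_update_eq hX N π f i
      rw [hc, hc, Submodule.coe_smul, linStat_smul]
      simp only [Pi.smul_apply, smul_eq_mul, mul_assoc]
      rw [integral_const_mul]
      ring)

lemma cumulantForm_apply (hX : HasSecondOrderLimitDistribution X P) (N r : ℕ)
    (f : Fin r → growthC1) :
    cumulantForm hX N r f = cumulant (P N) fun i => X.linStat (f i : ℝ → ℂ) N := rfl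

/-- The cumulants of order at least three of polynomial linear statistics with convergent
coefficients vanish asymptotically. -/
lemma tendsto_cumulantForm_sum (hX : HasSecondOrderLimitDistribution X P) {r : ℕ} (hr : 3 ≤ r)
    {d : ℕ} {c : ℕ → Fin d → ℂ} {a : Fin d → ℂ}
    (hc : ∀ k, Tendsto (fun N => c N k) atTop (𝓝 (a k))) :
    Tendsto (fun N => cumulantForm hX N r fun _ => ∑ k, c N k • powGrowthC1 k) atTop (𝓝 0) := by
  have hpow : ∀ κ : Fin r → Fin d,
      Tendsto (fun N => cumulantForm hX N r fun i => powGrowthC1 (κ i)) atTop (𝓝 0) := fun κ => by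
    refine (hX.cumulant_tendsto r hr fun i => (κ i : ℕ)).congr fun N => ?_
    rw [cumulantForm_apply]
    simp_rw [trPow_eq]
    rfl
  -- Multilinear expansion into finitely many cumulants of traces of powers, with convergent
  -- coefficients.
  simp_rw [MultilinearMap.map_sum, MultilinearMap.map_smul_univ]
  have : (0 : ℂ) = ∑ κ : Fin r → Fin d, (∏ i, a (κ i)) • (0 : ℂ) := by simp
  rw [this]
  exact tendsto_finsetSum _ fun κ _ =>
    (tendsto_finsetProd _ fun i _ => hc (κ i)).smul (hpow κ)

/-- The centered linear statistic of a real function. -/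
noncomputable def centered (X : SelfAdjointEnsemble Ω) (P : ∀ N, Measure (Ω N)) (f : ℝ → ℝ)
    (N : ℕ) (ω : Ω N) : ℝ :=
  X.linStat f N ω - ∫ ω', X.linStat f N ω' ∂(P N)

lemma measurable_centered {f : ℝ → ℝ} (hf : Continuous f) (N : ℕ) :
    Measurable (centered X P f N) :=
  (measurable_linStat_real X hf N).sub_const _

lemma ofReal_centered (f : ℝ → ℝ) (N : ℕ) (ω : Ω N) :
    (centered X P f N ω : ℂ) = X.linStat (fun x => (f x : ℂ)) N ω -
      ∫ ω', X.linStat (fun x => (f x : ℂ)) N ω' ∂(P N) := by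
  simp_rw [linStat_ofReal]
  rw [centered, integral_complex_ofReal]
  push_cast
  rfl

/-- A real function in `growthC1`. -/
def realGrowthC1 (f : ℝ → ℝ) (hf : ContDiff ℝ 1 f) (hg : PolyGrowth fun x => (f x : ℂ)) :
    growthC1 :=
  ⟨fun x => (f x : ℂ), (ofRealC1 f hf).2, hg⟩

lemma integrable_linStat_of_real (hX : HasSecondOrderLimitDistribution X P) {f : ℝ → ℝ}
    (hf : Continuous f) (hg : PolyGrowth fun x => (f x : ℂ)) (N : ℕ) :
    Integrable (X.linStat f N) (P N) := by
  have h := (integrable_linStat hX (f := fun x => (f x : ℂ))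
    (Complex.continuous_ofReal.comp hf) hg N).re
  refine h.congr (ae_of_all _ fun ω => ?_)
  simp only [linStat_ofReal]
  exact Complex.ofReal_re _

lemma covForm_realGrowthC1_self (hX : HasSecondOrderLimitDistribution X P) {f : ℝ → ℝ}
    (hf : ContDiff ℝ 1 f) (hg : PolyGrowth fun x => (f x : ℂ)) (N : ℕ) :
    covForm hX N (realGrowthC1 f hf hg) (realGrowthC1 f hf hg) =
      ((∫ ω, centered X P f N ω ^ 2 ∂(P N) : ℝ) : ℂ) := by
  rw [covForm_apply, cov_eq_integral (memLp_two_growthC1 hX _ N) (memLp_two_growthC1 hX _ N),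
    ← integral_complex_ofReal]
  congr 1
  funext ω
  rw [Complex.ofReal_pow, ofReal_centered, sq]
  rfl

/-- Applied to variances, this shows that the complex bilinear form is real and nonnegative on the
diagonal at real functions. -/
lemma exists_nnreal_of_tendsto_ofReal {u : ℕ → ℝ} (hu : ∀ N, 0 ≤ u N) {z : ℂ}
    (h : Tendsto (fun N => (u N : ℂ)) atTop (𝓝 z)) : ∃ v : ℝ≥0, z = ((v : ℝ) : ℂ) := by
  have hre : Tendsto u atTop (𝓝 z.re) := by
    simpa [Function.comp_def] using (Complex.continuous_re.tendsto z).comp h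
  have him : Tendsto (fun _ : ℕ => (0 : ℝ)) atTop (𝓝 z.im) := by
    simpa [Function.comp_def] using (Complex.continuous_im.tendsto z).comp h
  refine ⟨⟨z.re, ge_of_tendsto' hre hu⟩, Complex.ext rfl ?_⟩
  exact (tendsto_nhds_unique him tendsto_const_nhds).trans (Complex.ofReal_im _).symm

lemma polyGrowth_real_polynomial (p : Polynomial ℝ) :
    PolyGrowth fun x : ℝ => ((p.eval x : ℝ) : ℂ) := by
  have h := polyGrowth_polynomial (p.map Complex.ofRealHom)
  have e : (fun x : ℝ => (p.map Complex.ofRealHom).eval (x : ℂ)) =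
      fun x : ℝ => ((p.eval x : ℝ) : ℂ) :=
    funext fun x => Polynomial.eval_map_apply (f := Complex.ofRealHom) (p := p) x
  rwa [e] at h

/-- The centered statistic of a polynomial is the statistic of a polynomial with convergent
coefficients. -/
lemma exists_coeff_centered_polynomial (hX : HasSecondOrderLimitDistribution X P)
    (p : Polynomial ℝ) :
    ∃ (c : ℕ → Fin (p.natDegree + 1) → ℂ) (a : Fin (p.natDegree + 1) → ℂ),
      (∀ k, Tendsto (fun N => c N k) atTop (𝓝 (a k))) ∧
      ∀ N, 1 ≤ N → ∀ ω, (centered X P (fun x => p.eval x) N ω : ℂ) =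
        X.linStat ((∑ k, c N k • powGrowthC1 k : growthC1) : ℝ → ℂ) N ω := by
  choose a ha using hX.moment_tendsto
  have hpe : (fun x : ℝ => ((p.eval x : ℝ) : ℂ)) = ∑ k : Fin (p.natDegree + 1),
      (p.coeff k : ℂ) • (powGrowthC1 k : ℝ → ℂ) := by
    funext x
    rw [Polynomial.eval_eq_sum_range, Finset.sum_range]
    simp [powGrowthC1]
  -- `e N = (1/N) E Tr p(X_N)`. Since `Tr 1 = N`, centering amounts to subtracting `e N` from the
  -- constant coefficient, and `e N` converges by the first-order limits. This replaces translation
  -- invariance of cumulants.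
  set e : ℕ → ℂ := fun N => ∑ k : Fin (p.natDegree + 1),
    (p.coeff k : ℂ) * (1 / (N : ℂ) * ∫ ω, X.trPow k N ω ∂(P N)) with he
  have hlim : Tendsto e atTop (𝓝 (∑ k : Fin (p.natDegree + 1), (p.coeff k : ℂ) * a k)) :=
    tendsto_finsetSum _ fun k _ => (ha k).const_mul _
  refine ⟨fun N k => (p.coeff k : ℂ) - if k = 0 then e N else 0,
    fun k => (p.coeff k : ℂ) - if k = 0 then
      ∑ k : Fin (p.natDegree + 1), (p.coeff k : ℂ) * a k else 0, fun k => ?_, fun N hN ω => ?_⟩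
  · refine tendsto_const_nhds.sub ?_
    split_ifs
    · exact hlim
    · exact tendsto_const_nhds
  · have hN0 : (N : ℂ) ≠ 0 := by exact_mod_cast (by omega : N ≠ 0)
    have hmean : ∫ ω', X.linStat (fun x => ((p.eval x : ℝ) : ℂ)) N ω' ∂(P N) = N * e N := by
      rw [hpe, linStat_sum]
      simp only [Finset.sum_apply, linStat_smul, Pi.smul_apply, smul_eq_mul]
      rw [integral_finsetSum]
      · rw [he, Finset.mul_sum]
        refine Finset.sum_congr rfl fun k _ => ?_
        rw [integral_const_mul, trPow_eq]
        simp only [powGrowthC1]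
        field_simp
      · intro k _
        exact (integrable_linStat hX (growthC1.continuous _) (powGrowthC1 k).2.2 N).const_mul _
    have hone : X.linStat (powGrowthC1 0 : ℝ → ℂ) N ω = N := by
      simp [linStat_apply, powGrowthC1]
    have hs : (∑ k : Fin (p.natDegree + 1),
        ((p.coeff k : ℂ) - if k = 0 then e N else 0) • powGrowthC1 k : growthC1) =
        (∑ k : Fin (p.natDegree + 1), (p.coeff k : ℂ) • powGrowthC1 k) -
          e N • powGrowthC1 0 := by
      have : ∀ k : Fin (p.natDegree + 1),
          ((p.coeff k : ℂ) - if k = 0 then e N else 0) • powGrowthC1 k =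
          (p.coeff k : ℂ) • powGrowthC1 k - if k = 0 then e N • powGrowthC1 0 else 0 := by
        intro k
        refine (sub_smul _ _ (powGrowthC1 k)).trans ?_
        split_ifs with h
        · rw [h, Fin.val_zero]
        · rw [zero_smul]
      simp_rw [this]
      rw [Finset.sum_sub_distrib, Finset.sum_ite_eq']
      simp
    rw [ofReal_centered, hmean, hs]
    rw [Submodule.coe_sub, linStat_sub, Submodule.coe_smul, linStat_smul, Pi.sub_apply,
      Pi.smul_apply, hone, smul_eq_mul, mul_comm, hpe]
    simp only [Submodule.coe_sum, Submodule.coe_smul]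

lemma cumulant_const_eq {α : Type*} [MeasurableSpace α] (μ : Measure α) (Y : α → ℂ) (r : ℕ) :
    cumulant μ (fun _ : Fin r => Y) = cumulantOfMoments (fun k => ∫ a, Y a ^ k ∂μ) r := by
  simp [cumulant, cumulantOfMoments]

lemma integrable_centered_pow (hX : HasSecondOrderLimitDistribution X P) {f : ℝ → ℝ}
    (hf : Continuous f) (hg : PolyGrowth fun x => (f x : ℂ)) (N k : ℕ) :
    Integrable (fun ω => centered X P f N ω ^ k) (P N) := by
  have hfc : Continuous fun x => (f x : ℂ) := Complex.continuous_ofReal.comp hf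
  have h1 : MemLp (fun ω => (centered X P f N ω : ℂ)) k (P N) := by
    simp_rw [ofReal_centered]
    exact (memLp_linStat hX hfc hg N k).sub (memLp_const _)
  have h2 := h1.integrable_norm_pow'
  refine (integrable_norm_iff
    ((measurable_centered hf N).pow_const k).aestronglyMeasurable).1 (h2.congr ?_)
  exact ae_of_all _ fun ω => by simp

/-- Gaussian fluctuations of polynomial linear statistics. -/
lemma tendsto_charFun_centered_polynomial (hX : HasSecondOrderLimitDistribution X P)
    (p : Polynomial ℝ) {v : ℝ≥0}
    (hv : Tendsto (fun N => ((∫ ω, centered X P (fun x => p.eval x) N ω ^ 2 ∂(P N) : ℝ) : ℂ)) atTop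
      (𝓝 ((v : ℝ) : ℂ))) (t : ℝ) :
    Tendsto (fun N => charFun ((P N).map (centered X P (fun x => p.eval x) N)) t) atTop
      (𝓝 (charFun (gaussianReal 0 v) t)) := by
  set Y := centered X P (fun x => p.eval x) with hY
  have hpc : Continuous fun x : ℝ => p.eval x := p.continuous
  have hYm : ∀ N, Measurable (Y N) := fun N => measurable_centered hpc N
  have : ∀ N, IsProbabilityMeasure ((P N).map (Y N)) := fun N =>
    Measure.isProbabilityMeasure_map (hYm N).aemeasurable
  have hint := integrable_centered_pow hX hpc (polyGrowth_real_polynomial p)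
  have hmom : ∀ N (k : ℕ), ∫ x, (x : ℂ) ^ k ∂((P N).map (Y N)) = ∫ ω, (Y N ω : ℂ) ^ k ∂(P N) :=
    fun N k => integral_map (hYm N).aemeasurable (by fun_prop)
  refine tendsto_charFun_of_tendsto_moments (fun N k => ?_) ?_ t
  · rw [integrable_map_measure (by fun_prop) (hYm N).aemeasurable]
    exact hint N k
  simp_rw [hmom]
  obtain ⟨c, a, hc, hcY⟩ := exists_coeff_centered_polynomial hX p
  refine tendsto_gaussianMoment_of_cumulants (m := fun N k => ∫ ω, (Y N ω : ℂ) ^ k ∂(P N))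
    (fun N => by simp) (fun N => ?_) ?_ fun r hr => ?_
  · have hi := integrable_linStat_of_real hX hpc (polyGrowth_real_polynomial p) N
    simp only [pow_one]
    rw [integral_complex_ofReal, hY]
    unfold centered
    rw [integral_sub hi (integrable_const _)]
    simp
  · refine hv.congr fun N => ?_
    rw [← integral_complex_ofReal]
    simp
  -- The rewriting with convergent coefficients is valid only for `N ≥ 1`, hence eventual equality.
  · refine (tendsto_cumulantForm_sum hX hr hc).congr' ?_
    filter_upwards [eventually_ge_atTop 1] with N hN
    rw [cumulantForm_apply, ← cumulant_const_eq]
    congr 1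
    funext _ ω
    exact (hcY N hN ω).symm

end Cumulants

end SecondOrder

namespace SecondOrder

/-! ### The central limit theorem for `C¹` functions -/

section CentralLimit

variable {Ω : ℕ → Type u} [∀ N, MeasurableSpace (Ω N)] {P : ∀ N, Measure (Ω N)}
  [∀ N, IsProbabilityMeasure (P N)] {X : SelfAdjointEnsemble Ω} {M K : ℝ}

lemma PolynomiallyBounded.polyGrowth {f : ℝ → ℝ} (h : PolynomiallyBounded f) :
    PolyGrowth fun x => (f x : ℂ) := by
  obtain ⟨p, hp⟩ := h
  obtain ⟨C, m, hC⟩ := polyGrowth_real_polynomial p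
  refine ⟨C, m, fun x => ?_⟩
  refine le_trans ?_ (hC x)
  rw [Complex.norm_real, Complex.norm_real]
  exact (hp x).trans (le_abs_self _)

lemma norm_cexp_mul_I_sub_le (a b : ℝ) :
    ‖Complex.exp (a * Complex.I) - Complex.exp (b * Complex.I)‖ ≤ |a - b| := by
  have e : Complex.exp (a * Complex.I) - Complex.exp (b * Complex.I) =
      Complex.exp (b * Complex.I) * (Complex.exp (Complex.I * (a - b : ℝ)) - 1) := by
    rw [mul_sub, ← Complex.exp_add, mul_one]
    congr 2
    push_cast
    ring
  rw [e, norm_mul, Complex.norm_exp_ofReal_mul_I, one_mul]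
  exact Real.norm_exp_I_mul_ofReal_sub_one_le

lemma charFun_map_centered {f : ℝ → ℝ} (hf : Continuous f) (N : ℕ) (t : ℝ) :
    charFun ((P N).map (centered X P f N)) t =
      ∫ ω, Complex.exp ((t * centered X P f N ω : ℝ) * Complex.I) ∂(P N) := by
  rw [charFun_apply_real, integral_map (measurable_centered hf N).aemeasurable (by fun_prop)]
  simp

/-- `x ↦ exp(itx)` is `|t|`-Lipschitz, centering is linear, and on a probability space the `L¹` norm
is at most the `L²` norm. -/
lemma norm_charFun_centered_sub_le (hX : HasSecondOrderLimitDistribution X P) {f g : ℝ → ℝ}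
    (hf : ContDiff ℝ 1 f) (hfg : PolyGrowth fun x => (f x : ℂ))
    (hg : ContDiff ℝ 1 g) (hgg : PolyGrowth fun x => (g x : ℂ)) (N : ℕ) (t : ℝ) :
    ‖charFun ((P N).map (centered X P f N)) t - charFun ((P N).map (centered X P g N)) t‖ ≤
      |t| * stdDev (P N) (X.linStat
        ((realGrowthC1 f hf hfg - realGrowthC1 g hg hgg : growthC1) : ℝ → ℂ) N) := by
  have hi : ∀ {h : ℝ → ℝ}, Continuous h →
      Integrable (fun ω => Complex.exp ((t * centered X P h N ω : ℝ) * Complex.I)) (P N) := by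
    intro h hh
    have := measurable_centered (X := X) (P := P) hh N
    refine (integrable_const (1 : ℝ)).mono' (by fun_prop) (ae_of_all _ fun ω => ?_)
    rw [Complex.norm_exp_ofReal_mul_I]
  set F := realGrowthC1 f hf hfg
  set G := realGrowthC1 g hg hgg
  set W : Ω N → ℂ := fun ω => X.linStat ((F - G : growthC1) : ℝ → ℂ) N ω -
    ∫ ω', X.linStat ((F - G : growthC1) : ℝ → ℂ) N ω' ∂(P N) with hW
  have hWm : MemLp W 2 (P N) := memLp_sub_integral (memLp_two_growthC1 hX _ N)
  have hWe : ∀ ω, W ω = ((centered X P f N ω - centered X P g N ω : ℝ) : ℂ) := fun ω => by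
    rw [Complex.ofReal_sub, ofReal_centered, ofReal_centered, hW]
    simp only [Submodule.coe_sub, linStat_sub, Pi.sub_apply]
    rw [integral_sub ((memLp_two_growthC1 hX F N).integrable (by norm_num))
      ((memLp_two_growthC1 hX G N).integrable (by norm_num))]
    simp only [F, G, realGrowthC1]
    ring
  rw [charFun_map_centered hf.continuous, charFun_map_centered hg.continuous,
    ← integral_sub (hi hf.continuous) (hi hg.continuous)]
  refine le_trans (norm_integral_le_of_norm_le (g := fun ω => |t| * ‖W ω‖)
    ((hWm.integrable (by norm_num)).norm.const_mul _) (ae_of_all _ fun ω => ?_)) ?_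
  · refine (norm_cexp_mul_I_sub_le _ _).trans (le_of_eq ?_)
    rw [hWe, Complex.norm_real, ← mul_sub, abs_mul, Real.norm_eq_abs]
  · rw [integral_const_mul]
    exact mul_le_mul_of_nonneg_left (integral_norm_le_l2Norm hWm) (abs_nonneg t)

lemma exists_real_polynomial_deriv_near {f : ℝ → ℝ} (hf : ContDiff ℝ 1 f)
    (hg : PolyGrowth fun x => (f x : ℂ)) (M : ℝ) {ε : ℝ} (hε : 0 < ε) :
    ∃ (p : Polynomial ℝ) (hp : ContDiff ℝ 1 fun x : ℝ => p.eval x),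
      ∀ x ∈ Set.Icc (-M) M, ‖deriv ((realGrowthC1 f hf hg -
        realGrowthC1 _ hp (polyGrowth_real_polynomial p) : growthC1) : ℝ → ℂ) x‖ ≤ ε := by
  obtain ⟨p, hp⟩ := exists_polynomial_derivative_near (hf.continuous_deriv le_rfl) M hε
  have hpc : ContDiff ℝ 1 fun x : ℝ => p.eval x := by
    simp_rw [Polynomial.eval_eq_sum_range]
    fun_prop
  refine ⟨p, hpc, fun x hx => ?_⟩
  have h1 : HasDerivAt (fun x => (f x : ℂ) - ((p.eval x : ℝ) : ℂ))
      (((deriv f x : ℝ) : ℂ) - (((Polynomial.derivative p).eval x : ℝ) : ℂ)) x :=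
    ((hf.differentiable one_ne_zero x).hasDerivAt.ofReal_comp).sub (p.hasDerivAt x).ofReal_comp
  have h2 : deriv ((realGrowthC1 f hf hg -
        realGrowthC1 _ hpc (polyGrowth_real_polynomial p) : growthC1) : ℝ → ℂ) x =
      ((deriv f x : ℝ) : ℂ) - (((Polynomial.derivative p).eval x : ℝ) : ℂ) := h1.deriv
  rw [h2, ← Complex.ofReal_sub, Complex.norm_real, Real.norm_eq_abs]
  exact (hp x hx).le

lemma exists_norm_charFun_gaussianReal_sub_lt (t : ℝ) {v : ℝ≥0} {ε : ℝ} (hε : 0 < ε) :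
    ∃ η > 0, ∀ w : ℝ≥0, ‖((v : ℝ) : ℂ) - ((w : ℝ) : ℂ)‖ < η →
      ‖charFun (gaussianReal 0 v) t - charFun (gaussianReal 0 w) t‖ < ε := by
  have hc : Continuous fun z : ℂ => Complex.exp (t * (0 : ℝ) * Complex.I - z * t ^ 2 / 2) := by
    fun_prop
  obtain ⟨η, hη, h⟩ := Metric.continuous_iff.1 hc ((v : ℝ) : ℂ) ε hε
  refine ⟨η, hη, fun w hw => ?_⟩
  rw [charFun_gaussianReal, charFun_gaussianReal, ← dist_eq_norm, dist_comm]
  refine h ((w : ℝ) : ℂ) ?_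
  rwa [dist_comm, dist_eq_norm]

/-- With `h = f - g`, `B(f,f) - B(g,g) = B(h,f) + B(f,h) - B(h,h)`. The condition `δ ≤ 1` makes the
quadratic term linear in `δ`. -/
lemma norm_apply_self_sub_le {B : growthC1 →ₗ[ℂ] growthC1 →ₗ[ℂ] ℂ} (hK : 0 < K)
    (hB : ∀ f g : growthC1, ‖B f g‖ ≤
        K * supNormOn M (deriv (f : ℝ → ℂ)) * supNormOn M (deriv (g : ℝ → ℂ)))
    {f g : growthC1} {δ : ℝ} (hδ0 : 0 ≤ δ) (hδ1 : δ ≤ 1)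
    (h : ∀ x ∈ Set.Icc (-M) M, ‖deriv ((f - g : growthC1) : ℝ → ℂ) x‖ ≤ δ) :
    ‖B f f - B g g‖ ≤ K * (2 * supNormOn M (deriv (f : ℝ → ℂ)) + 1) * δ := by
  have hsup : supNormOn M (deriv ((f - g : growthC1) : ℝ → ℂ)) ≤ δ := supNormOn_le hδ0 h
  set S := supNormOn M (deriv ((f - g : growthC1) : ℝ → ℂ)) with hS
  set F := supNormOn M (deriv (f : ℝ → ℂ)) with hF
  have hS0 : 0 ≤ S := supNormOn_nonneg _ _
  have hF0 : 0 ≤ F := supNormOn_nonneg _ _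
  have e : B f f - B g g = B (f - g) f + B f (f - g) - B (f - g) (f - g) := by
    simp only [map_sub, LinearMap.sub_apply]
    ring
  rw [e]
  have h1 := hB (f - g) f
  have h2 := hB f (f - g)
  have h3 := hB (f - g) (f - g)
  calc _ ≤ ‖B (f - g) f‖ + ‖B f (f - g)‖ + ‖B (f - g) (f - g)‖ :=
        (norm_sub_le _ _).trans (by gcongr; exact norm_add_le _ _)
    _ ≤ K * S * F + K * F * S + K * S * S := by gcongr
    _ ≤ K * δ * F + K * F * δ + K * δ * 1 := by
        have : S ≤ 1 := hsup.trans hδ1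
        gcongr
    _ = _ := by ring

/-- Gaussian fluctuations of `C¹` linear statistics. -/
lemma tendsto_charFun_centered (hX : HasSecondOrderLimitDistribution X P) (hM : 0 < M)
    (hA1 : NormTailBound X P M) (hK : 0 < K) (hA2 : VarianceBound X P K)
    {B : growthC1 →ₗ[ℂ] growthC1 →ₗ[ℂ] ℂ}
    (hlim : ∀ f g, Tendsto (fun N => covForm hX N f g) atTop (𝓝 (B f g)))
    (hB : ∀ f g : growthC1, ‖B f g‖ ≤
        K * supNormOn M (deriv (f : ℝ → ℂ)) * supNormOn M (deriv (g : ℝ → ℂ)))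
    {f : ℝ → ℝ} (hf : ContDiff ℝ 1 f) (hfg : PolyGrowth fun x => (f x : ℂ)) {v : ℝ≥0}
    (hv : B (realGrowthC1 f hf hfg) (realGrowthC1 f hf hfg) = ((v : ℝ) : ℂ)) (t : ℝ) :
    Tendsto (fun N => charFun ((P N).map (centered X P f N)) t) atTop
      (𝓝 (charFun (gaussianReal 0 v) t)) := by
  rw [Metric.tendsto_nhds]
  intro ε hε
  obtain ⟨η, hη, hgauss⟩ := exists_norm_charFun_gaussianReal_sub_lt t (v := v)
    (show 0 < ε / 3 by positivity)
  set F := realGrowthC1 f hf hfg with hF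
  set D := K * (2 * supNormOn M (deriv (F : ℝ → ℂ)) + 1) with hD
  have hD0 : 0 < D := by
    have := supNormOn_nonneg M (deriv (F : ℝ → ℂ))
    positivity
  -- One `δ` serves twice: `D * δ < η` keeps the limit variances close, and the last condition keeps
  -- the characteristic functions of the two statistics close, the summand `+ δ` being the tolerance
  -- in the asymptotic variance bound.
  obtain ⟨δ, hδ0, hδ1, hδη, hδε⟩ : ∃ δ : ℝ, 0 < δ ∧ δ ≤ 1 ∧ D * δ < η ∧
      |t| * (√K * δ + δ) < ε / 3 := by
    have h1 : Tendsto (fun δ : ℝ => D * δ) (𝓝[>] 0) (𝓝 0) := by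
      have : Continuous fun δ : ℝ => D * δ := by fun_prop
      simpa using (this.tendsto 0).mono_left nhdsWithin_le_nhds
    have h2 : Tendsto (fun δ : ℝ => |t| * (√K * δ + δ)) (𝓝[>] 0) (𝓝 0) := by
      have : Continuous fun δ : ℝ => |t| * (√K * δ + δ) := by fun_prop
      simpa using (this.tendsto 0).mono_left nhdsWithin_le_nhds
    obtain ⟨δ, h⟩ := ((show ∀ᶠ δ : ℝ in 𝓝[>] 0, δ ∈ Set.Ioo 0 1 from Ioo_mem_nhdsGT one_pos).and
      ((h1.eventually (gt_mem_nhds hη)).and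
        (h2.eventually (gt_mem_nhds (show 0 < ε / 3 by positivity))))).exists
    exact ⟨δ, h.1.1, h.1.2.le, h.2.1, h.2.2⟩
  obtain ⟨p, hpc, hp⟩ := exists_real_polynomial_deriv_near hf hfg M hδ0
  set G := realGrowthC1 _ hpc (polyGrowth_real_polynomial p) with hG
  have hG2 := hlim G G
  simp_rw [hG, covForm_realGrowthC1_self] at hG2
  obtain ⟨w, hw⟩ := exists_nnreal_of_tendsto_ofReal
    (fun N => integral_nonneg fun ω => sq_nonneg _) hG2
  rw [hw] at hG2
  have hvw : ‖((v : ℝ) : ℂ) - ((w : ℝ) : ℂ)‖ < η := by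
    rw [← hv, ← hw]
    exact (norm_apply_self_sub_le hK hB hδ0.le hδ1 hp).trans_lt hδη
  have hpoly := tendsto_charFun_centered_polynomial hX p hG2 t
  filter_upwards [Metric.tendsto_nhds.1 hpoly (ε / 3) (by positivity),
    eventually_stdDev_linStat_le hX hM hA1 hK hA2 (F - G : growthC1).2.1 (F - G : growthC1).2.2
      hp hδ0] with N h1 h2
  have h3 := norm_charFun_centered_sub_le hX hf hfg hpc (polyGrowth_real_polynomial p) N t
  have h4 : ‖charFun ((P N).map (centered X P f N)) t -
      charFun ((P N).map (centered X P (fun x => p.eval x) N)) t‖ < ε / 3 :=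
    (h3.trans (mul_le_mul_of_nonneg_left h2 (abs_nonneg t))).trans_lt hδε
  have h5 := hgauss w hvw
  rw [← dist_eq_norm] at h4 h5
  rw [dist_comm] at h5
  calc _ ≤ _ := dist_triangle4 _ (charFun ((P N).map (centered X P (fun x => p.eval x) N)) t)
        (charFun (gaussianReal 0 w) t) _
    _ < ε := by linarith

end CentralLimit

end SecondOrder

/-! ### The theorem -/

open SecondOrder in
theorem proposition3p6 {Ω : ℕ → Type u} [∀ N, MeasurableSpace (Ω N)]
    (P : ∀ N, Measure (Ω N)) [∀ N, IsProbabilityMeasure (P N)]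
    (X : SelfAdjointEnsemble Ω)
    (hX : HasSecondOrderLimitDistribution X P)
    (M : ℝ) (hM : 0 < M) (hA1 : NormTailBound X P M)
    (K : ℝ) (hK : 0 < K) (hA2 : VarianceBound X P K) :
    ∃ ρ : C1On M →ₗ[ℂ] C1On M →ₗ[ℂ] ℂ,
      IsCovarianceExtension X P M K ρ ∧
      (∀ ρ', IsCovarianceExtension X P M K ρ' → ρ' = ρ) ∧
      ∀ (f : ℝ → ℝ) (hf : ContDiff ℝ 1 f), PolynomiallyBounded f →
        (∀ N, Integrable (X.linStat f N) (P N)) ∧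
        ∃ v : ℝ≥0,
          ρ (restrict M (ofRealC1 f hf)) (restrict M (ofRealC1 f hf)) = (v : ℂ) ∧
          TendstoInDistribution
            (fun N ω => X.linStat f N ω - ∫ ω', X.linStat f N ω' ∂(P N))
            atTop (id : ℝ → ℝ) P (gaussianReal 0 v) := by
  obtain ⟨B, hlim, hB⟩ := exists_limitForm hX hM hA1 hK hA2
  obtain ⟨ρ, hρ⟩ := exists_descent hM B hB
  have hext := isCovarianceExtension_of_limitForm hX hM hlim hB hρ
  refine ⟨ρ, hext, fun ρ' h' => hext.unique h', fun f hf hfb => ?_⟩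
  have hfg := hfb.polyGrowth
  refine ⟨integrable_linStat_of_real hX hf.continuous hfg, ?_⟩
  have hlimf := hlim (realGrowthC1 f hf hfg) (realGrowthC1 f hf hfg)
  simp_rw [covForm_realGrowthC1_self] at hlimf
  obtain ⟨v, hv⟩ := exists_nnreal_of_tendsto_ofReal
    (fun N => integral_nonneg fun ω => sq_nonneg _) hlimf
  refine ⟨v, (hρ (realGrowthC1 f hf hfg) (realGrowthC1 f hf hfg)).trans hv, ?_⟩
  have hmeas : ∀ N, AEMeasurable (centered X P f N) (P N) := fun N =>
    (measurable_centered hf.continuous N).aemeasurable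
  have hd : TendstoInDistribution (centered X P f) atTop (id : ℝ → ℝ) P (gaussianReal 0 v) := by
    -- Lévy's continuity theorem.
    refine ⟨hmeas, aemeasurable_id, ProbabilityMeasure.tendsto_of_tendsto_charFun fun t => ?_⟩
    simp only [ProbabilityMeasure.coe_mk, Measure.map_id]
    exact tendsto_charFun_centered hX hM hA1 hK hA2 hlim hB hf hfg hv t
  exact hd
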